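/- Let $\mathcal{H}=\{H_1,\dots,H_m\}$ be a finite collection of affine hyperplanes in $\mathbb{R}^n$ that is essential (the normal vectors span $\mathbb{R}^n$) and non-central ($\bigcap_i H_i=\emptyset$). Let $\mathcal{L}$ be its intersection lattice, that is, the set of all intersections of hyperplanes of $\mathcal{H}$ (including $\mathbb{R}^n$, the empty intersection, and the empty set $\emptyset$), ordered by reverse inclusion, so that $\emptyset$ is the maximal element $\hat{1}$. Let $\mathcal{L}\cup\{\hat{0}\}$ be $\mathcal{L}$ with a new minimal element $\hat{0}$ adjoined; it is a graded poset, with rank function $\rho$ and Möbius function $\mu$. For $x\le y$ in it put $$Z([x,y])=\sum_{x\le w\le y}(-1)^{\rho(w)-\rho(x)}\mu(x,w),\qquad Z_b([x,y])=(-1)^{\rho(y)-\rho(x)}\mu(x,y),$$ $$Z_{ub}([x,y])=Z([x,y])-2\,Z_b([x,y]).$$ The faces of $\mathcal{H}$ are the closures of the cells into which $\mathcal{H}$ divides $\mathbb{R}^n$ (a cell is a nonempty set of all points having a given position, on the hyperplane or on one of its two open sides, with respect to each $H_i$). Let $Q$ be the poset of all unbounded faces of $\mathcal{H}$, ordered by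 reverse inclusion, with a minimal element $\hat{0}$ and a maximal element $\hat{1}$ adjoined. Let $z_{ub}\colon Q\to\mathcal{L}\cup\{\hat{0}\}$ be the order-preserving map that sends each unbounded face to its affine hull, $\hat{0}$ to $\hat{0}$, and $\hat{1}$ to $\hat{1}=\emptyset$. It maps chains of $Q$ to chains of $\mathcal{L}\cup\{\hat{0}\}$; for a chain $c$, let $z_{ub}^{-1}(c)$ denote the set of chains $d$ of $Q$ with $z_{ub}(d)=c$. **Theorem.** Let $c=\{\hat{0}=x_0<x_1<\dots<x_k=\hat{1}\}$ be a chain in $\mathcal{L}\cup\{\hat{0}\}$ with $k\ge 2$. Then $z_{ub}^{-1}(c)$ is finite and $$|z_{ub}^{-1}(c)|=\prod_{i=2}^{k-1}Z([x_{i-1},x_i])\cdot Z_{ub}([x_{k-1},x_k]).$$ -/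

import Mathlib

noncomputable section

/-- A finite collection of affine hyperplanes `H_i = {x | ⟪a_i, x⟫ = b_i}`, `a_i ≠ 0`, in
`n`-dimensional Euclidean space. -/
structure HyperplaneArrangement (n m : ℕ) where
  normal : Fin m → EuclideanSpace ℝ (Fin n)
  offset : Fin m → ℝ
  normal_ne_zero : ∀ i, normal i ≠ 0

namespace HyperplaneArrangement

variable {n m : ℕ} (A : HyperplaneArrangement n m)

/-- The affine function `x ↦ ⟪a_i, x⟫ - b_i`, whose zero set is the `i`-th hyperplane. -/
def form (i : Fin m) (x : EuclideanSpace ℝ (Fin n)) : ℝ :=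
  inner ℝ (A.normal i) x - A.offset i

/-- The `i`-th hyperplane, as an affine subspace. -/
def hyperplane (i : Fin m) : AffineSubspace ℝ (EuclideanSpace ℝ (Fin n)) where
  carrier := {x | inner ℝ (A.normal i) x = A.offset i}
  smul_vsub_vadd_mem' := by
    intro c p q r hp hq hr
    simp only [Set.mem_ofPred_eq] at *
    simp [inner_add_right, inner_sub_right, inner_smul_right, hp, hq, hr]

/-- The normal vectors of the hyperplanes span the whole space. -/
def IsEssential : Prop := Submodule.span ℝ (Set.range A.normal) = ⊤

/-- The intersection of all the hyperplanes is empty. -/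
def IsNonCentral : Prop := ⋂ i, (A.hyperplane i : Set (EuclideanSpace ℝ (Fin n))) = ∅

/-- The intersection of the hyperplanes indexed by `S` (the whole space if `S = ∅`). -/
def flat (S : Set (Fin m)) : AffineSubspace ℝ (EuclideanSpace ℝ (Fin n)) :=
  ⨅ i ∈ S, A.hyperplane i

theorem mem_hyperplane {i : Fin m} {x : EuclideanSpace ℝ (Fin n)} :
    x ∈ A.hyperplane i ↔ A.form i x = 0 :=
  sub_eq_zero.symm

theorem mem_flat {S : Set (Fin m)} {x : EuclideanSpace ℝ (Fin n)} :
    x ∈ A.flat S ↔ ∀ i ∈ S, A.form i x = 0 := by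
  simp [flat, AffineSubspace.mem_iInf_iff, mem_hyperplane]

/-- The intersection lattice: all intersections of hyperplanes of the arrangement, ordered by
reverse inclusion. For a non-central arrangement the empty set is one of these intersections, and
it is the maximal element. -/
def IntersectionLattice : Type :=
  {X : (AffineSubspace ℝ (EuclideanSpace ℝ (Fin n)))ᵒᵈ //
    ∃ S : Set (Fin m), X = OrderDual.toDual (A.flat S)}

instance : PartialOrder A.IntersectionLattice :=
  inferInstanceAs (PartialOrder {X : (AffineSubspace ℝ (EuclideanSpace ℝ (Fin n)))ᵒᵈ //
    ∃ S : Set (Fin m), X = OrderDual.toDual (A.flat S)})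

instance : BoundedOrder A.IntersectionLattice where
  bot := ⟨OrderDual.toDual (A.flat ∅), ∅, rfl⟩
  bot_le := by
    rintro ⟨_, S, rfl⟩
    change A.flat S ≤ A.flat ∅
    intro x _
    simp [mem_flat]
  top := ⟨OrderDual.toDual (A.flat Set.univ), Set.univ, rfl⟩
  le_top := by
    rintro ⟨_, S, rfl⟩
    change A.flat Set.univ ≤ A.flat S
    intro x hx
    rw [mem_flat] at hx ⊢
    exact fun i _ => hx i (Set.mem_univ i)

instance : Finite A.IntersectionLattice :=
  Finite.of_surjective
    (fun S : Set (Fin m) =>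
      (⟨OrderDual.toDual (A.flat S), S, rfl⟩ : A.IntersectionLattice))
    (by rintro ⟨_, S, rfl⟩; exact ⟨S, rfl⟩)

open Classical in
/-- `L ∪ {0̂}`, the intersection lattice with a new minimal element adjoined, has finite
intervals since it is finite. -/
instance : LocallyFiniteOrder (WithBot A.IntersectionLattice) :=
  letI : Fintype (WithBot A.IntersectionLattice) :=
    @Fintype.ofFinite _ (inferInstanceAs (Finite (Option A.IntersectionLattice)))
  Fintype.toLocallyFiniteOrder

/-- The (relatively open) cell of the point `p`: all points that lie on the same side of, or both
on, each of the hyperplanes. -/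
def cell (p : EuclideanSpace ℝ (Fin n)) : Set (EuclideanSpace ℝ (Fin n)) :=
  {q | ∀ i, SignType.sign (A.form i q) = SignType.sign (A.form i p)}

/-- A (nonempty, closed) face of the arrangement is the closure of a cell. -/
def IsFace (F : Set (EuclideanSpace ℝ (Fin n))) : Prop :=
  ∃ p, F = closure (A.cell p)

theorem continuous_form (i : Fin m) : Continuous (A.form i) := by
  unfold form
  fun_prop

theorem exists_flat_of_isFace {F : Set (EuclideanSpace ℝ (Fin n))} (hF : A.IsFace F) :
    ∃ S : Set (Fin m), affineSpan ℝ F = A.flat S := by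
  obtain ⟨p, rfl⟩ := hF
  refine ⟨{i | A.form i p = 0}, le_antisymm ?_ ?_⟩
  · rw [affineSpan_le]
    have hcl : IsClosed (A.flat {i | A.form i p = 0} : Set (EuclideanSpace ℝ (Fin n))) :=
      AffineSubspace.closed_of_finiteDimensional _
    refine closure_minimal (fun q hq => ?_) hcl
    refine A.mem_flat.2 fun i hi => ?_
    have h := hq i
    rw [show A.form i p = 0 from hi, sign_zero, sign_eq_zero_iff] at h
    exact h
  · intro q hq
    rw [mem_flat] at hq
    have key : ∀ᶠ t : ℝ in nhds 0, AffineMap.lineMap p q t ∈ A.cell p := by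
      simp only [cell, Set.mem_ofPred_eq]
      rw [Filter.eventually_all]
      intro i
      have hcont : Continuous fun t : ℝ => A.form i (AffineMap.lineMap p q t) :=
        (A.continuous_form i).comp AffineMap.lineMap_continuous
      have h0 : A.form i (AffineMap.lineMap p q (0 : ℝ)) = A.form i p := by simp
      rcases lt_trichotomy (A.form i p) 0 with h | h | h
      · filter_upwards [hcont.continuousAt.eventually_lt continuousAt_const
          (by rw [h0]; exact h)] with t ht
        rw [sign_neg ht, sign_neg h]
      · refine Filter.Eventually.of_forall fun t => ?_
        have hm : AffineMap.lineMap p q t ∈ A.hyperplane i :=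
          AffineMap.lineMap_mem t (A.mem_hyperplane.2 h) (A.mem_hyperplane.2 (hq i h))
        rw [A.mem_hyperplane.1 hm, h]
      · filter_upwards [continuousAt_const.eventually_lt hcont.continuousAt
          (by rw [h0]; exact h)] with t ht
        rw [sign_pos ht, sign_pos h]
    obtain ⟨t, ht, ht0⟩ := ((key.filter_mono nhdsWithin_le_nhds).and
      (self_mem_nhdsWithin : Set.Ioi (0 : ℝ) ∈ nhdsWithin 0 (Set.Ioi 0))).exists
    have ht0' : t ≠ 0 := ne_of_gt ht0
    have hp : p ∈ affineSpan ℝ (closure (A.cell p)) :=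
      subset_affineSpan ℝ _ (subset_closure fun i => rfl)
    have hr : AffineMap.lineMap p q t ∈ affineSpan ℝ (closure (A.cell p)) :=
      subset_affineSpan ℝ _ (subset_closure ht)
    have := AffineMap.lineMap_mem (t⁻¹) hp hr
    simpa [AffineMap.lineMap_apply, smul_smul, ht0'] using this

/-- The unbounded (nonempty, closed) faces, ordered by inclusion. -/
def UnboundedFace : Type :=
  {F : Set (EuclideanSpace ℝ (Fin n)) // A.IsFace F ∧ ¬ Bornology.IsBounded F}

instance : PartialOrder A.UnboundedFace :=
  inferInstanceAs (PartialOrder {F : Set (EuclideanSpace ℝ (Fin n)) //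
    A.IsFace F ∧ ¬ Bornology.IsBounded F})

/-- The poset `Q`: the unbounded faces ordered by reverse inclusion, together with a minimal
element (the formal maximal element of the face lattice, which is the minimal element of its dual)
and an adjoined maximal element. -/
abbrev UnboundedPoset : Type := WithTop (WithBot (A.UnboundedFace)ᵒᵈ)

/-- The affine hull of an unbounded face, as an element of the intersection lattice. -/
def hull : (A.UnboundedFace)ᵒᵈ →o A.IntersectionLattice where
  toFun F := ⟨OrderDual.toDual (affineSpan ℝ (OrderDual.ofDual F).1), by
    obtain ⟨S, hS⟩ := A.exists_flat_of_isFace (OrderDual.ofDual F).2.1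
    exact ⟨S, congrArg _ hS⟩⟩
  monotone' _ _ h := affineSpan_mono ℝ h

/-- The map `z_ub : Q → L ∪ {0̂}`, sending a face to its affine hull, the minimal element to the
new minimal element `0̂`, and the maximal element to the maximal element of `L`. -/
def zub : A.UnboundedPoset →o WithBot A.IntersectionLattice where
  toFun := WithTop.recTopCoe ⊤ (WithBot.map A.hull)
  monotone' := by
    intro p q h
    induction q using WithTop.recTopCoe with
    | top => exact le_top
    | coe q =>
      induction p using WithTop.recTopCoe with
      | top => simp at h
      | coe p => exact A.hull.monotone.withBot_map (WithTop.coe_le_coe.1 h)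

end HyperplaneArrangement

section Zaslavsky

open Classical

variable {P : Type*} [PartialOrder P] [LocallyFiniteOrder P]

/-- The rank function of a graded poset: the rank of `x` is the length of a longest chain
ending in `x`. -/
def rk (x : P) : ℕ := (Order.height x).toNat

/-- The Zaslavsky invariant `Z([a, b])` of the interval `[a, b]` of a graded poset, whose rank
function is `x ↦ rk x - rk a`. -/
def zaslavsky (a b : P) : ℤ :=
  ∑ x ∈ Finset.Icc a b, (-1) ^ (rk x - rk a) * IncidenceAlgebra.mu ℤ a x

/-- The bounded Zaslavsky invariant `Z_b([a, b])`. -/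
def zaslavskyBounded (a b : P) : ℤ :=
  (-1) ^ (rk b - rk a) * IncidenceAlgebra.mu ℤ a b

/-- The unbounded Zaslavsky invariant `Z_ub([a, b])`. -/
def zaslavskyUnbounded (a b : P) : ℤ :=
  zaslavsky a b - 2 * zaslavskyBounded a b

end Zaslavsky

end

/-!
Both factors of the formula count faces. A chain of `Q` over `c` is a flag of unbounded faces
`F_1 ⊋ ⋯ ⊋ F_{k-1}` with affine hulls `x_1, …, x_{k-1}`, closed off by the two adjoined elements.
Going down from the top, there are `Z_ub([x_{k-1}, 1̂])` choices for `F_{k-1}`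
(`ncard_zub_eq`, `card_localCells_not_recTrivial`), and once `F_i` is chosen there are
`Z([x_{i-1}, x_i])` choices for `F_{i-1}` (`ncard_le_zub_eq`, `card_localCells`): the faces that
contain `F_i` and span `x_{i-1}` look, near a relative interior point of `F_i`, like the cells that
span `x_{i-1}` in the arrangement of all hyperplanes containing `x_i`, and they are unbounded
because `F_i` is. As the number of choices does not depend on `F_i`, the numbers multiply
(`ncard_chains_over`).

Cells are encoded by sign vectors, and the counts come from two Euler relations for the cells of an
arrangement in an affine subspace `W`: the sum of `(-1) ^ dim` is `(-1) ^ dim W` over all cells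
(`sum_cells_neg_one_pow`), and `1` over the bounded cells if the arrangement is essential
(`sum_cells_recTrivial_neg_one_pow`). Both are proved by adding the hyperplanes one at a time. A
hyperplane that cuts a cell of dimension `d` replaces it by two cells of dimension `d` and one of
dimension `d - 1`, which does not change the first sum. For the second sum, a cell counts as bounded
if its recession cone lies in the lineality space, a condition that makes sense for every
arrangement; if a hyperplane parallel to the lineality space cuts an unbounded cell in a bounded
section, then exactly one of the two other pieces is bounded, and it cancels the section. Any other
hyperplane cuts every cell, and lowers the dimensions of the lineality space and of the bounded
cells by one.

Summing the relations over the flats `y ≥ w`, for every `w` in an interval of the lattice, and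
applying Möbius inversion gives the number of cells with a given affine hull. The signs agree with
those in the Zaslavsky invariants since the rank of a nonempty flat is `n + 1` minus its dimension
and that of the empty set is `n + 2` (`height_eq_level`).
-/

noncomputable section

open Classical

/-! ### Möbius inversion -/

/-- Möbius inversion in an interval. -/
theorem eq_sum_mu_mul_of_sum_Icc {P : Type*} [PartialOrder P] [LocallyFiniteOrder P] {f g : P → ℤ}
    {a b : P} (hab : a ≤ b) (h : ∀ w ∈ Finset.Icc a b, g w = ∑ y ∈ Finset.Icc w b, f y) :
    f a = ∑ w ∈ Finset.Icc a b, IncidenceAlgebra.mu ℤ a w * g w := by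
  have h1 : ∑ w ∈ Finset.Icc a b, IncidenceAlgebra.mu ℤ a w * g w =
      ∑ w ∈ Finset.Icc a b, ∑ y ∈ Finset.Icc w b, IncidenceAlgebra.mu ℤ a w * f y :=
    Finset.sum_congr rfl fun w hw => by rw [h w hw, Finset.mul_sum]
  rw [h1, Finset.sum_comm' (t' := Finset.Icc a b) (s' := fun y => Finset.Icc a y)]
  · simp_rw [← Finset.sum_mul, IncidenceAlgebra.sum_Icc_mu_right]
    simp [hab]
  · intro w y
    simp only [Finset.mem_Icc]
    constructor
    · rintro ⟨⟨h1, h2⟩, h3, h4⟩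
      exact ⟨⟨h1, h3⟩, h1.trans h3, h4⟩
    · rintro ⟨⟨h1, h2⟩, h3, h4⟩
      exact ⟨⟨h1, h2.trans h4⟩, h2, h4⟩

/-- A function whose sums over the intervals `[w, b]`, `w < b`, are all `1` is, up to sign, the
Möbius function. -/
theorem eq_neg_mu_of_sum_Icc_eq_one {P : Type*} [PartialOrder P] [LocallyFiniteOrder P] {f : P → ℤ}
    {a b : P} (hab : a < b) (hb : f b = 0)
    (h : ∀ w ∈ Finset.Icc a b, w ≠ b → ∑ y ∈ Finset.Icc w b, f y = 1) :
    f a = -IncidenceAlgebra.mu ℤ a b := by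
  have hmem : b ∈ Finset.Icc a b := Finset.right_mem_Icc.2 hab.le
  have hmu := IncidenceAlgebra.sum_Icc_mu_right (𝕜 := ℤ) a b
  rw [if_neg hab.ne, ← Finset.sum_erase_add _ _ hmem] at hmu
  rw [eq_sum_mu_mul_of_sum_Icc (f := f) (g := fun w => if w = b then 0 else 1) hab.le,
    ← Finset.sum_erase_add _ _ hmem, if_pos rfl, mul_zero, add_zero, eq_neg_iff_add_eq_zero, ← hmu]
  · congr 1
    refine Finset.sum_congr rfl fun w hw => ?_
    rw [if_neg (Finset.ne_of_mem_erase hw), mul_one]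
  · intro w hw
    split_ifs with hwb
    · rw [hwb, Finset.Icc_self, Finset.sum_singleton, hb]
    · exact (h w hw hwb).symm

namespace HyperplaneArrangement

/-! ### Sign vectors relative to some of the hyperplanes -/

section SignVectors

variable {n m : ℕ} (A : HyperplaneArrangement n m)

/-- The linear part `v ↦ ⟪a_i, v⟫` of the affine function `A.form i`. -/
def lin (i : Fin m) : EuclideanSpace ℝ (Fin n) →ₗ[ℝ] ℝ :=
  (innerSL ℝ (A.normal i)).toLinearMap

theorem lin_apply (i : Fin m) (v : EuclideanSpace ℝ (Fin n)) :
    A.lin i v = inner ℝ (A.normal i) v := rfl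

theorem form_add (i : Fin m) (p v : EuclideanSpace ℝ (Fin n)) :
    A.form i (p + v) = A.form i p + A.lin i v := by
  simp only [form, lin_apply, inner_add_right]; ring

theorem form_add_smul (i : Fin m) (p v : EuclideanSpace ℝ (Fin n)) (t : ℝ) :
    A.form i (p + t • v) = A.form i p + t * A.lin i v := by
  rw [form_add, map_smul, smul_eq_mul]

theorem lin_sub (i : Fin m) (p q : EuclideanSpace ℝ (Fin n)) :
    A.lin i (q - p) = A.form i q - A.form i p := by
  simp only [form, lin_apply, inner_sub_right]; ring

/-- The sign vector of a point with respect to the hyperplanes indexed by `S`. Outside `S` its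
entries are `1`, so that the zero entries are exactly the hyperplanes of `S` through the point. -/
def signs (S : Finset (Fin m)) (p : EuclideanSpace ℝ (Fin n)) : Fin m → SignType :=
  fun i => if i ∈ S then SignType.sign (A.form i p) else 1

/-- The sign vectors, with respect to the hyperplanes indexed by `S`, of the points of `W`. They
stand for the cells into which these hyperplanes divide `W`. -/
def cells (W : AffineSubspace ℝ (EuclideanSpace ℝ (Fin n))) (S : Finset (Fin m)) :
    Finset (Fin m → SignType) :=
  {σ | ∃ p ∈ W, A.signs S p = σ}

/-- The vectors of `D` that are parallel to all hyperplanes on which `σ` vanishes. For a cell of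
an affine subspace with direction `D` this is the direction of its affine hull. -/
def zeroDir (D : Submodule ℝ (EuclideanSpace ℝ (Fin n))) (σ : Fin m → SignType) :
    Submodule ℝ (EuclideanSpace ℝ (Fin n)) :=
  D ⊓ ⨅ i, ⨅ _ : σ i = 0, LinearMap.ker (A.lin i)

/-- The vectors of `D` that are parallel to all hyperplanes indexed by `S`. -/
def lineality (D : Submodule ℝ (EuclideanSpace ℝ (Fin n))) (S : Finset (Fin m)) :
    Submodule ℝ (EuclideanSpace ℝ (Fin n)) :=
  D ⊓ ⨅ i ∈ S, LinearMap.ker (A.lin i)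

/-- `v` is a recession direction, with respect to the hyperplanes indexed by `S`, of the cell with
sign vector `σ`. -/
def IsRec (S : Finset (Fin m)) (σ : Fin m → SignType) (v : EuclideanSpace ℝ (Fin n)) : Prop :=
  ∀ i ∈ S, A.lin i v = 0 ∨ SignType.sign (A.lin i v) = σ i

/-- The cell of `σ` is bounded up to translations parallel to all hyperplanes: each of its
recession directions in `D` is parallel to all hyperplanes indexed by `S`. -/
def RecTrivial (D : Submodule ℝ (EuclideanSpace ℝ (Fin n))) (S : Finset (Fin m))
    (σ : Fin m → SignType) : Prop :=
  ∀ v ∈ D, A.IsRec S σ v → ∀ i ∈ S, A.lin i v = 0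

variable {A} {W : AffineSubspace ℝ (EuclideanSpace ℝ (Fin n))} {S : Finset (Fin m)} {h : Fin m}
  {σ : Fin m → SignType} {D : Submodule ℝ (EuclideanSpace ℝ (Fin n))}
  {p q v : EuclideanSpace ℝ (Fin n)}

theorem mem_cells : σ ∈ A.cells W S ↔ ∃ p ∈ W, A.signs S p = σ := by simp [cells]

theorem mem_zeroDir : v ∈ A.zeroDir D σ ↔ v ∈ D ∧ ∀ i, σ i = 0 → A.lin i v = 0 := by
  simp [zeroDir, Submodule.mem_iInf]

theorem mem_lineality : v ∈ A.lineality D S ↔ v ∈ D ∧ ∀ i ∈ S, A.lin i v = 0 := by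
  simp [lineality, Submodule.mem_iInf]

theorem signs_eq_zero {i : Fin m} : A.signs S p i = 0 ↔ i ∈ S ∧ A.form i p = 0 := by
  by_cases hi : i ∈ S <;> simp [signs, hi]

theorem signs_of_mem {i : Fin m} (hi : i ∈ S) : A.signs S p i = SignType.sign (A.form i p) := by
  simp [signs, hi]

theorem signs_insert (hS : h ∉ S) (p : EuclideanSpace ℝ (Fin n)) :
    A.signs (insert h S) p =
      Function.update (A.signs S p) h (SignType.sign (A.form h p)) := by
  ext i
  by_cases hi : i = h
  · subst hi; simp [signs]
  · simp [signs, hi]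

theorem signs_apply_of_notMem (hS : h ∉ S) : A.signs S p h = 1 := by simp [signs, hS]

theorem signs_eq_signs : A.signs S p = A.signs S q ↔
    ∀ i ∈ S, SignType.sign (A.form i p) = SignType.sign (A.form i q) := by
  constructor
  · intro e i hi
    have := congrFun e i
    simpa [signs, hi] using this
  · intro e
    ext i
    by_cases hi : i ∈ S
    · simp [signs, hi, e i hi]
    · simp [signs, hi]

theorem add_smul_mem (hp : p ∈ W) (hv : v ∈ W.direction) (t : ℝ) : p + t • v ∈ W := by
  have := AffineSubspace.vadd_mem_of_mem_direction (W.direction.smul_mem t hv) hp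
  rwa [vadd_eq_add, add_comm] at this

theorem sub_mem_direction (hp : p ∈ W) (hq : q ∈ W) : q - p ∈ W.direction := by
  simpa using AffineSubspace.vsub_mem_direction hq hp

/-- A small displacement within the affine hull of a cell does not leave the cell. -/
theorem exists_pos_signs_add_smul (hv : ∀ i, A.signs S p i = 0 → A.lin i v = 0) :
    ∃ ε > 0, ∀ t : ℝ, |t| ≤ ε → A.signs S (p + t • v) = A.signs S p := by
  have key : ∀ᶠ t : ℝ in nhds 0, A.signs S (p + t • v) = A.signs S p := by
    simp only [signs_eq_signs]
    rw [Filter.eventually_all_finset]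
    intro i hi
    simp only [form_add_smul]
    have hcont : Continuous fun t : ℝ => A.form i p + t * A.lin i v := by fun_prop
    have h0 : A.form i p + 0 * A.lin i v = A.form i p := by simp
    rcases lt_trichotomy (A.form i p) 0 with h | h | h
    · filter_upwards [hcont.continuousAt.eventually_lt continuousAt_const
        (by rw [h0]; exact h)] with t ht
      rw [sign_neg ht, sign_neg h]
    · refine Filter.Eventually.of_forall fun t => ?_
      rw [hv i (signs_eq_zero.2 ⟨hi, h⟩)]; simp
    · filter_upwards [continuousAt_const.eventually_lt hcont.continuousAt
        (by rw [h0]; exact h)] with t ht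
      rw [sign_pos ht, sign_pos h]
  obtain ⟨ε, hε, H⟩ := Metric.eventually_nhds_iff.1 key
  refine ⟨ε / 2, by positivity, fun t ht => H ?_⟩
  rw [Real.dist_eq, sub_zero]; linarith

/-- Recession directions stay within the cell. -/
theorem signs_add_of_isRec (hv : A.IsRec S (A.signs S p) v) {t : ℝ} (ht : 0 ≤ t) :
    A.signs S (p + t • v) = A.signs S p := by
  rw [signs_eq_signs]
  intro i hi
  rw [form_add_smul]
  rcases hv i hi with h | h
  · simp [h]
  · rw [signs_of_mem hi] at h
    rcases lt_trichotomy (A.form i p) 0 with h' | h' | h'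
    · rw [sign_neg h', sign_eq_neg_one_iff] at h
      rw [sign_neg h', sign_neg (by nlinarith)]
    · rw [h', sign_zero, sign_eq_zero_iff] at h
      simp [h]
    · rw [sign_pos h', sign_eq_one_iff] at h
      rw [sign_pos h', sign_pos (by nlinarith)]

theorem finrank_inf_ker_add_one (f : EuclideanSpace ℝ (Fin n) →ₗ[ℝ] ℝ) (hv : v ∈ D)
    (hf : f v ≠ 0) :
    Module.finrank ℝ ↥(D ⊓ LinearMap.ker f) + 1 = Module.finrank ℝ D := by
  have h1 : (f.domRestrict D : Module.Dual ℝ D) ≠ 0 := by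
    intro h0
    exact hf (by simpa using LinearMap.congr_fun h0 ⟨v, hv⟩)
  rw [← Module.Dual.finrank_ker_add_one_of_ne_zero h1]
  have e : D ⊓ LinearMap.ker f = (LinearMap.ker (f.domRestrict D)).map D.subtype := by
    ext x
    simp [and_comm]
  rw [e, Submodule.finrank_map_subtype_eq]

/-! ### Adding one hyperplane to an arrangement -/

/-- The positions, with respect to the hyperplane `h`, of the points of `W` in the cell `σ`. -/
def newSigns (A : HyperplaneArrangement n m) (W : AffineSubspace ℝ (EuclideanSpace ℝ (Fin n)))
    (S : Finset (Fin m)) (h : Fin m) (σ : Fin m → SignType) : Finset SignType :=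
  {s | ∃ q ∈ W, A.signs S q = σ ∧ SignType.sign (A.form h q) = s}

theorem mem_newSigns {s : SignType} : s ∈ A.newSigns W S h σ ↔
    ∃ q ∈ W, A.signs S q = σ ∧ SignType.sign (A.form h q) = s := by simp [newSigns]

theorem sum_cells_insert (hS : h ∉ S) (w : (Fin m → SignType) → ℤ) :
    ∑ σ ∈ A.cells W (insert h S), w σ =
      ∑ σ ∈ A.cells W S, ∑ s ∈ A.newSigns W S h σ, w (Function.update σ h s) := by
  have hmaps : ∀ σ ∈ A.cells W (insert h S), Function.update σ h 1 ∈ A.cells W S := by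
    intro σ hσ
    obtain ⟨p, hp, rfl⟩ := mem_cells.1 hσ
    refine mem_cells.2 ⟨p, hp, ?_⟩
    rw [signs_insert hS, Function.update_idem, ← signs_apply_of_notMem (A := A) (p := p) hS,
      Function.update_eq_self]
  rw [← Finset.sum_fiberwise_of_maps_to hmaps]
  refine Finset.sum_congr rfl fun σ hσ => ?_
  have hinj : Set.InjOn (Function.update σ h) (A.newSigns W S h σ : Set SignType) :=
    fun s _ t _ hst => Function.update_injective σ h hst
  rw [← Finset.sum_image (g := Function.update σ h) hinj]
  refine Finset.sum_congr ?_ fun _ _ => rfl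
  ext τ
  simp only [Finset.mem_filter, Finset.mem_image, mem_newSigns, mem_cells]
  constructor
  · rintro ⟨⟨p, hp, rfl⟩, hτ⟩
    have : A.signs S p = σ := by
      rw [← hτ, signs_insert hS, Function.update_idem,
        ← signs_apply_of_notMem (A := A) (p := p) hS, Function.update_eq_self]
    exact ⟨_, ⟨p, hp, this, rfl⟩, by rw [signs_insert hS, this]⟩
  · rintro ⟨s, ⟨p, hp, hps, rfl⟩, rfl⟩
    refine ⟨⟨p, hp, by rw [signs_insert hS, hps]⟩, ?_⟩
    rw [Function.update_idem, ← hps, ← signs_apply_of_notMem (A := A) (p := p) hS,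
      Function.update_eq_self]

/-- If a cell has points on `h` and `h` is not parallel to it, then it is cut into three pieces. -/
theorem newSigns_eq_univ (hp : p ∈ W) (hpσ : A.signs S p = σ) (hp0 : A.form h p = 0)
    (hv : v ∈ A.zeroDir W.direction σ) (hvh : A.lin h v ≠ 0) :
    A.newSigns W S h σ = Finset.univ := by
  rw [mem_zeroDir, ← hpσ] at hv
  obtain ⟨ε, hε, H⟩ := exists_pos_signs_add_smul hv.2
  have hmem : ∀ t : ℝ, |t| ≤ ε → SignType.sign (t * A.lin h v) ∈ A.newSigns W S h σ := by
    intro t ht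
    refine mem_newSigns.2 ⟨p + t • v, add_smul_mem hp hv.1 t, (H t ht).trans hpσ, ?_⟩
    rw [form_add_smul, hp0, zero_add]
  have h0 := hmem 0 (by simpa using hε.le)
  have h1 := hmem ε (by rw [abs_of_pos hε])
  have h2 := hmem (-ε) (by rw [abs_neg, abs_of_pos hε])
  rw [zero_mul, sign_zero] at h0
  rw [sign_mul, sign_pos hε, one_mul] at h1
  rw [sign_mul, Left.sign_neg, sign_pos hε] at h2
  refine Finset.eq_univ_of_forall fun s => ?_
  rcases lt_or_gt_of_ne hvh with hlt | hlt
  · rw [sign_neg hlt] at h1 h2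
    rcases s with _ | _ | _ <;> assumption
  · rw [sign_pos hlt] at h1 h2
    rcases s with _ | _ | _ <;> assumption

/-- The three ways in which a cell can lie with respect to a further hyperplane. -/
theorem newSigns_cases (hσ : σ ∈ A.cells W S) :
    (∃ s ≠ 0, A.newSigns W S h σ = {s}) ∨
    (A.newSigns W S h σ = {0} ∧ ∀ v ∈ A.zeroDir W.direction σ, A.lin h v = 0) ∨
    (A.newSigns W S h σ = Finset.univ ∧ ∃ v ∈ A.zeroDir W.direction σ, A.lin h v ≠ 0) := by
  obtain ⟨p, hp, hpσ⟩ := mem_cells.1 hσ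
  have hdir : ∀ {a b}, a ∈ W → b ∈ W → A.signs S a = σ → A.signs S b = σ →
      b - a ∈ A.zeroDir W.direction σ := by
    intro a b ha hb haσ hbσ
    refine mem_zeroDir.2 ⟨sub_mem_direction ha hb, fun i hi => ?_⟩
    rw [lin_sub, (signs_eq_zero.1 ((congrFun haσ i).trans hi)).2,
      (signs_eq_zero.1 ((congrFun hbσ i).trans hi)).2, sub_zero]
  by_cases hz : ∃ q ∈ W, A.signs S q = σ ∧ A.form h q = 0
  · obtain ⟨q, hq, hqσ, hq0⟩ := hz
    by_cases hv : ∃ v ∈ A.zeroDir W.direction σ, A.lin h v ≠ 0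
    · obtain ⟨v, hv, hvh⟩ := hv
      exact Or.inr (Or.inr ⟨newSigns_eq_univ hq hqσ hq0 hv hvh, v, hv, hvh⟩)
    · push Not at hv
      refine Or.inr (Or.inl ⟨?_, hv⟩)
      ext s
      rw [mem_newSigns, Finset.mem_singleton]
      constructor
      · rintro ⟨a, ha, haσ, rfl⟩
        have := hv _ (hdir hq ha hqσ haσ)
        rw [lin_sub, hq0, sub_zero] at this
        rw [this, sign_zero]
      · rintro rfl
        exact ⟨q, hq, hqσ, by rw [hq0, sign_zero]⟩
  · push Not at hz
    refine Or.inl ⟨SignType.sign (A.form h p), by simpa using hz p hp hpσ, ?_⟩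
    ext s
    rw [mem_newSigns, Finset.mem_singleton]
    constructor
    · rintro ⟨a, ha, haσ, rfl⟩
      by_contra hne
      -- Points on opposite sides: the segment between them stays in the cell and meets `h`.
      have hpn := hz p hp hpσ
      have han := hz a ha haσ
      have hprod : A.form h a * A.form h p < 0 := by
        rcases lt_or_gt_of_ne hpn with h1 | h1 <;> rcases lt_or_gt_of_ne han with h2 | h2
        · exact absurd (by rw [sign_neg h1, sign_neg h2]) hne
        · exact mul_neg_of_pos_of_neg h2 h1
        · exact mul_neg_of_neg_of_pos h2 h1
        · exact absurd (by rw [sign_pos h1, sign_pos h2]) hne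
      have hd : A.form h p - A.form h a ≠ 0 := by
        intro h0
        have : A.form h p = A.form h a := by linarith
        rw [this] at hprod
        nlinarith [mul_self_nonneg (A.form h a)]
      set t := A.form h p / (A.form h p - A.form h a) with ht
      have ht0 : 0 ≤ t ∧ t ≤ 1 := by
        rcases lt_or_gt_of_ne hpn with h1 | h1
        · have h2 : 0 < A.form h a := by nlinarith
          constructor
          · exact div_nonneg_of_nonpos h1.le (by linarith)
          · rw [ht, div_le_one_of_neg (by linarith)]; linarith
        · have h2 : A.form h a < 0 := by nlinarith
          constructor
          · exact div_nonneg h1.le (by linarith)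
          · rw [ht, div_le_one (by linarith)]; linarith
      refine hz (p + t • (a - p)) (add_smul_mem hp (sub_mem_direction hp ha) t) ?_ ?_
      · rw [← hpσ, signs_eq_signs]
        intro i hi
        have hs := signs_eq_signs.1 (hpσ.trans haσ.symm) i hi
        rw [form_add_smul, lin_sub]
        rcases lt_trichotomy (A.form i p) 0 with h1 | h1 | h1
        · rw [sign_neg h1] at hs ⊢
          have h2 := sign_eq_neg_one_iff.1 hs.symm
          refine sign_neg ?_
          rcases ht0.1.eq_or_lt with e | e
          · rw [← e]; simpa using h1
          · nlinarith
        · rw [h1, sign_zero] at hs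
          rw [h1, sign_eq_zero_iff.1 hs.symm]; simp
        · rw [sign_pos h1] at hs ⊢
          have h2 := sign_eq_one_iff.1 hs.symm
          refine sign_pos ?_
          rcases ht0.1.eq_or_lt with e | e
          · rw [← e]; simpa using h1
          · nlinarith
      · rw [form_add_smul, lin_sub, ht]
        field_simp
        ring
    · rintro rfl
      exact ⟨p, hp, hpσ, rfl⟩

theorem zeroDir_update_of_ne_zero (hσ : σ h ≠ 0) {s : SignType} (hs : s ≠ 0) :
    A.zeroDir D (Function.update σ h s) = A.zeroDir D σ := by
  ext v
  simp only [mem_zeroDir]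
  refine and_congr_right fun _ => forall_congr' fun i => ?_
  by_cases hi : i = h
  · subst hi; simp [hσ, hs]
  · simp [hi]

theorem zeroDir_update_zero (hσ : σ h ≠ 0) :
    A.zeroDir D (Function.update σ h 0) = A.zeroDir D σ ⊓ LinearMap.ker (A.lin h) := by
  ext v
  simp only [mem_zeroDir, Submodule.mem_inf, LinearMap.mem_ker]
  constructor
  · rintro ⟨h1, h2⟩
    refine ⟨⟨h1, fun i hi => h2 i ?_⟩, h2 h (by simp)⟩
    have : i ≠ h := by rintro rfl; exact hσ hi
    simpa [this] using hi
  · rintro ⟨⟨h1, h2⟩, h3⟩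
    refine ⟨h1, fun i hi => ?_⟩
    by_cases hih : i = h
    · subst hih; exact h3
    · exact h2 i (by simpa [hih] using hi)

theorem ne_zero_of_mem_cells (hS : h ∉ S) (hσ : σ ∈ A.cells W S) : σ h ≠ 0 := by
  obtain ⟨p, -, rfl⟩ := mem_cells.1 hσ
  rw [signs_apply_of_notMem hS]; decide

theorem sum_univ_signType (g : SignType → ℤ) : ∑ s, g s = g 0 + g (-1) + g 1 := by
  have : (Finset.univ : Finset SignType) = {0, -1, 1} := by decide
  rw [this, Finset.sum_insert (by decide), Finset.sum_insert (by decide), Finset.sum_singleton]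
  ring

theorem cells_empty (hp : p ∈ W) : A.cells W ∅ = {fun _ => 1} := by
  ext σ
  rw [mem_cells, Finset.mem_singleton]
  constructor
  · rintro ⟨q, -, rfl⟩; ext i; simp [signs]
  · rintro rfl; exact ⟨p, hp, by ext i; simp [signs]⟩

theorem zeroDir_one : A.zeroDir D (fun _ => 1) = D := by
  ext v
  simp [mem_zeroDir]

/-- Euler's relation for the cells of an arrangement in an affine subspace. A new hyperplane
either does not change a cell or cuts it into two cells of the same dimension and one of dimension
one less, so the alternating sum stays the same. -/
theorem sum_cells_neg_one_pow (hp : p ∈ W) (S : Finset (Fin m)) :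
    ∑ σ ∈ A.cells W S, (-1 : ℤ) ^ Module.finrank ℝ (A.zeroDir W.direction σ) =
      (-1) ^ Module.finrank ℝ W.direction := by
  induction S using Finset.induction_on with
  | empty => rw [cells_empty hp, Finset.sum_singleton, zeroDir_one]
  | insert h S hS ih =>
    rw [sum_cells_insert hS, ← ih]
    refine Finset.sum_congr rfl fun σ hσ => ?_
    have hσh := ne_zero_of_mem_cells hS hσ
    rcases newSigns_cases (h := h) hσ with ⟨s, hs, e⟩ | ⟨e, hv⟩ | ⟨e, v, hv, hvh⟩
    · rw [e, Finset.sum_singleton, zeroDir_update_of_ne_zero hσh hs]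
    · rw [e, Finset.sum_singleton, zeroDir_update_zero hσh]
      have : A.zeroDir W.direction σ ⊓ LinearMap.ker (A.lin h) = A.zeroDir W.direction σ :=
        inf_eq_left.2 fun v h => hv v h
      rw [this]
    · rw [e, sum_univ_signType, zeroDir_update_zero hσh,
        zeroDir_update_of_ne_zero hσh (by decide), zeroDir_update_of_ne_zero hσh (by decide),
        ← finrank_inf_ker_add_one (A.lin h) hv hvh, pow_succ]
      ring

/-! ### The relation for bounded cells -/

theorem isRec_insert (hS : h ∉ S) {s : SignType} :
    A.IsRec (insert h S) (Function.update σ h s) v ↔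
      (A.lin h v = 0 ∨ SignType.sign (A.lin h v) = s) ∧ A.IsRec S σ v := by
  simp only [IsRec, Finset.forall_mem_insert, Function.update_self]
  refine and_congr_right fun _ => forall₂_congr fun i hi => ?_
  rw [Function.update_of_ne (by rintro rfl; exact hS hi)]

theorem IsRec.add {u : EuclideanSpace ℝ (Fin n)} (hv : A.IsRec S σ v) (hu : A.IsRec S σ u) :
    A.IsRec S σ (v + u) := by
  intro i hi
  rw [map_add]
  rcases hv i hi with h1 | h1 <;> rcases hu i hi with h2 | h2
  · left; rw [h1, h2, add_zero]
  · right; rw [h1, zero_add, h2]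
  · right; rw [h2, add_zero, h1]
  · right
    rw [← h1] at h2 ⊢
    rcases lt_trichotomy (A.lin i v) 0 with h | h | h
    · rw [sign_neg h, sign_eq_neg_one_iff] at h2
      rw [sign_neg h, sign_neg (by linarith)]
    · rw [h, zero_add, h2, h]
    · rw [sign_pos h, sign_eq_one_iff] at h2
      rw [sign_pos h, sign_pos (by linarith)]

theorem IsRec.smul (hv : A.IsRec S σ v) {c : ℝ} (hc : 0 < c) : A.IsRec S σ (c • v) := by
  intro i hi
  rw [map_smul, smul_eq_mul, sign_mul, sign_pos hc, one_mul]
  exact (hv i hi).imp (fun h => by rw [h, mul_zero]) id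

/-- If a sum of two recession directions is parallel to all hyperplanes, so is each of them. -/
theorem IsRec.eq_zero_of_add {u : EuclideanSpace ℝ (Fin n)} (hv : A.IsRec S σ v)
    (hu : A.IsRec S σ u) (h : ∀ i ∈ S, A.lin i (v + u) = 0) : ∀ i ∈ S, A.lin i v = 0 := by
  intro i hi
  have h0 := h i hi
  rw [map_add] at h0
  rcases hv i hi with h1 | h1
  · exact h1
  rcases hu i hi with h2 | h2
  · rwa [h2, add_zero] at h0
  rw [← h1] at h2
  rcases lt_trichotomy (A.lin i v) 0 with h | h | h
  · rw [sign_neg h, sign_eq_neg_one_iff] at h2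
    linarith
  · exact h
  · rw [sign_pos h, sign_eq_one_iff] at h2
    linarith

/-- When `h` is parallel to the lineality space, the pieces into which `h` cuts a cell contribute
to the bounded count together as much as the cell does: if an unbounded cell has a bounded
section with `h`, then its recession cone lies strictly on one side of `h`, and exactly one of the
two other pieces is bounded. -/
theorem sum_newSigns_recTrivial (hS : h ∉ S) (hσ : σ ∈ A.cells W S)
    (hL : ∀ l ∈ A.lineality W.direction S, A.lin h l = 0) :
    ∑ s ∈ A.newSigns W S h σ,
      (if A.RecTrivial W.direction (insert h S) (Function.update σ h s) then
        (-1 : ℤ) ^ Module.finrank ℝ (A.zeroDir W.direction (Function.update σ h s)) else 0) =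
      if A.RecTrivial W.direction S σ then
        (-1 : ℤ) ^ Module.finrank ℝ (A.zeroDir W.direction σ) else 0 := by
  have hσh := ne_zero_of_mem_cells hS hσ
  have key : ∀ s, A.RecTrivial W.direction (insert h S) (Function.update σ h s) ↔
      ∀ v ∈ W.direction, A.IsRec S σ v → (A.lin h v = 0 ∨ SignType.sign (A.lin h v) = s) →
        ∀ i ∈ S, A.lin i v = 0 := by
    intro s
    simp only [RecTrivial, isRec_insert hS, and_imp, Finset.forall_mem_insert]
    constructor
    · exact fun H v hv h1 h2 => (H v hv h2 h1).2
    · exact fun H v hv h1 h2 =>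
        ⟨hL v (mem_lineality.2 ⟨hv, H v hv h2 h1⟩), H v hv h2 h1⟩
  -- A cell on one side of `h` has all its recession directions on that side.
  have single : ∀ s, A.newSigns W S h σ = {s} →
      (A.RecTrivial W.direction (insert h S) (Function.update σ h s) ↔
        A.RecTrivial W.direction S σ) := by
    intro s hs
    rw [key]
    refine forall₃_congr fun v hv hrec => ?_
    refine ⟨fun H => H ?_, fun H _ => H⟩
    obtain ⟨p, hp, hpσ⟩ := mem_cells.1 hσ
    have hside : ∀ t : ℝ, 0 ≤ t → SignType.sign (A.form h p + t * A.lin h v) = s := by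
      intro t ht
      rw [← form_add_smul]
      have : SignType.sign (A.form h (p + t • v)) ∈ A.newSigns W S h σ :=
        mem_newSigns.2 ⟨_, add_smul_mem hp hv t,
          by rw [signs_add_of_isRec (by rwa [hpσ]) ht, hpσ], rfl⟩
      rwa [hs, Finset.mem_singleton] at this
    by_cases hz : A.lin h v = 0
    · exact Or.inl hz
    right
    have h1 := hside ((|A.form h p| + 1) / |A.lin h v|) (by positivity)
    have hpos := abs_pos.2 hz
    rcases lt_or_gt_of_ne hz with hlt | hlt
    · rw [← h1, sign_neg hlt, sign_neg]
      rw [abs_of_neg hlt, div_mul_eq_mul_div, div_neg, mul_div_assoc, div_self hz]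
      linarith [le_abs_self (A.form h p)]
    · rw [← h1, sign_pos hlt, sign_pos]
      rw [abs_of_pos hlt, div_mul_cancel₀ _ hz]
      linarith [neg_abs_le (A.form h p)]
  rcases newSigns_cases (h := h) hσ with ⟨s, hs, e⟩ | ⟨e, hv⟩ | ⟨e, v, hv, hvh⟩
  · rw [e, Finset.sum_singleton, zeroDir_update_of_ne_zero hσh hs]
    simp only [single s e]
  · rw [e, Finset.sum_singleton, zeroDir_update_zero hσh]
    have : A.zeroDir W.direction σ ⊓ LinearMap.ker (A.lin h) = A.zeroDir W.direction σ :=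
      inf_eq_left.2 fun v h => hv v h
    rw [this]
    simp only [single 0 e]
  · rw [e, sum_univ_signType, zeroDir_update_zero hσh,
      zeroDir_update_of_ne_zero hσh (by decide), zeroDir_update_of_ne_zero hσh (by decide),
      ← finrank_inf_ker_add_one (A.lin h) hv hvh, pow_succ]
    by_cases hR : A.RecTrivial W.direction S σ
    · have : ∀ s, A.RecTrivial W.direction (insert h S) (Function.update σ h s) :=
        fun s => (key s).2 fun v hv hrec _ => hR v hv hrec
      simp only [this, hR, if_true]
      ring
    · by_cases h0 : A.RecTrivial W.direction (insert h S) (Function.update σ h 0)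
      · obtain ⟨r, hr, hrec, hrL⟩ : ∃ r ∈ W.direction, A.IsRec S σ r ∧
            ¬ ∀ i ∈ S, A.lin i r = 0 := by
          simpa only [RecTrivial, not_forall, exists_prop] using hR
        rw [key] at h0
        have hrh : A.lin h r ≠ 0 := fun e => hrL (h0 r hr hrec (Or.inl e))
        have h1 : ¬ A.RecTrivial W.direction (insert h S)
            (Function.update σ h (SignType.sign (A.lin h r))) :=
          fun H => hrL ((key _).1 H r hr hrec (Or.inr rfl))
        have h2 : A.RecTrivial W.direction (insert h S)
            (Function.update σ h (-SignType.sign (A.lin h r))) := by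
          rw [key]
          intro u hu hurec hus
          by_cases huh : A.lin h u = 0
          · exact h0 u hu hurec (Or.inl huh)
          have hus := hus.resolve_left huh
          -- A positive combination of `r` and `u` is parallel to `h`.
          exfalso
          have hc : A.lin h (|A.lin h u| • r + |A.lin h r| • u) = 0 := by
            rw [map_add, map_smul, map_smul, smul_eq_mul, smul_eq_mul]
            rcases lt_or_gt_of_ne hrh with hlt | hlt
            · rw [sign_neg hlt, neg_neg, sign_eq_one_iff] at hus
              rw [abs_of_pos hus, abs_of_neg hlt]; ring
            · rw [sign_pos hlt, sign_eq_neg_one_iff] at hus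
              rw [abs_of_neg hus, abs_of_pos hlt]; ring
          have hr' := hrec.smul (abs_pos.2 huh)
          have hu' := hurec.smul (abs_pos.2 hrh)
          have hz := hr'.eq_zero_of_add hu' (h0 _ (W.direction.add_mem
            (W.direction.smul_mem _ hr) (W.direction.smul_mem _ hu)) (hr'.add hu') (Or.inl hc))
          refine hrL fun i hi => ?_
          have := hz i hi
          rw [map_smul, smul_eq_mul] at this
          exact (mul_eq_zero.1 this).resolve_left (abs_pos.2 huh).ne'
        have h0' := (key 0).2 h0
        rcases lt_or_gt_of_ne hrh with hlt | hlt
        · rw [sign_neg hlt] at h1 h2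
          rw [neg_neg] at h2
          simp only [h0', h1, h2, hR, if_true, if_false]
          ring
        · rw [sign_pos hlt] at h1 h2
          simp only [h0', h1, h2, hR, if_true, if_false]
          ring
      · have : ∀ s, ¬ A.RecTrivial W.direction (insert h S) (Function.update σ h s) := by
          intro s hs
          rw [key] at hs
          refine h0 ((key 0).2 fun v hv hrec h0 => hs v hv hrec (Or.inl ?_))
          exact h0.elim id fun h => sign_eq_zero_iff.1 h
        simp only [this, hR, if_false]
        ring

theorem lineality_insert : A.lineality D (insert h S) =
    A.lineality D S ⊓ LinearMap.ker (A.lin h) := by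
  ext v
  simp only [mem_lineality, Finset.forall_mem_insert, Submodule.mem_inf, LinearMap.mem_ker]
  tauto

/-- Euler's relation for the bounded cells: their alternating sum is that of a single cell of the
dimension of the lineality space. -/
theorem sum_cells_recTrivial_neg_one_pow (hp : p ∈ W) (S : Finset (Fin m)) :
    ∑ σ ∈ A.cells W S, (if A.RecTrivial W.direction S σ then
      (-1 : ℤ) ^ Module.finrank ℝ (A.zeroDir W.direction σ) else 0) =
      (-1) ^ Module.finrank ℝ (A.lineality W.direction S) := by
  induction S using Finset.induction_on with
  | empty =>
    have h1 : A.lineality W.direction ∅ = W.direction := by ext; simp [mem_lineality]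
    have h2 : A.RecTrivial W.direction ∅ (fun _ => 1) := by
      intro v _ _ i hi; simp at hi
    rw [cells_empty hp, Finset.sum_singleton, zeroDir_one, h1, if_pos h2]
  | insert h S hS ih =>
    rw [sum_cells_insert hS]
    by_cases hL : ∀ l ∈ A.lineality W.direction S, A.lin h l = 0
    · have : A.lineality W.direction (insert h S) = A.lineality W.direction S := by
        rw [lineality_insert]
        exact inf_eq_left.2 fun v h => hL v h
      rw [this, ← ih]
      exact Finset.sum_congr rfl fun σ hσ => sum_newSigns_recTrivial hS hσ hL
    · push Not at hL
      obtain ⟨l, hl, hlh⟩ := hL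
      have hlD := mem_lineality.1 hl
      -- Every cell is invariant under translation by `l`, hence is cut by `h` into three pieces,
      -- and only the middle one can be bounded.
      have key : ∀ σ ∈ A.cells W S, ∑ s ∈ A.newSigns W S h σ,
          (if A.RecTrivial W.direction (insert h S) (Function.update σ h s) then (-1 : ℤ) ^
            Module.finrank ℝ (A.zeroDir W.direction (Function.update σ h s)) else 0) =
          -(if A.RecTrivial W.direction S σ then
            (-1 : ℤ) ^ Module.finrank ℝ (A.zeroDir W.direction σ) else 0) := by
        intro σ hσ
        have hσh := ne_zero_of_mem_cells hS hσ
        obtain ⟨p, hp, hpσ⟩ := mem_cells.1 hσ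
        have htrans : ∀ t : ℝ, A.signs S (p + t • l) = σ := by
          intro t
          rw [← hpσ, signs_eq_signs]
          intro i hi
          rw [form_add_smul, hlD.2 i hi, mul_zero, add_zero]
        have hlz : l ∈ A.zeroDir W.direction σ := by
          refine mem_zeroDir.2 ⟨hlD.1, fun i hi => hlD.2 i ?_⟩
          rw [← hpσ, signs_eq_zero] at hi
          exact hi.1
        have huniv : A.newSigns W S h σ = Finset.univ := by
          refine newSigns_eq_univ (add_smul_mem hp hlD.1 (-A.form h p / A.lin h l))
            (htrans _) ?_ hlz hlh
          rw [form_add_smul]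
          field_simp
          ring
        have hne : ∀ c : ℝ, c ≠ 0 → ¬ A.RecTrivial W.direction (insert h S)
            (Function.update σ h (SignType.sign (A.lin h (c • l)))) := by
          intro c hc H
          have := H (c • l) (W.direction.smul_mem c hlD.1)
            ((isRec_insert hS).2 ⟨Or.inr rfl, fun i hi => Or.inl ?_⟩) h (by simp)
          · rw [map_smul, smul_eq_mul] at this
            exact (mul_ne_zero hc hlh) this
          · rw [map_smul, hlD.2 i hi, smul_zero]
        have h1 := hne (A.lin h l) hlh
        have h2 := hne (-A.lin h l) (neg_ne_zero.2 hlh)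
        rw [map_smul, smul_eq_mul, sign_pos (mul_self_pos.2 hlh)] at h1
        rw [map_smul, smul_eq_mul, neg_mul, Left.sign_neg, sign_pos (mul_self_pos.2 hlh)] at h2
        have h0 : A.RecTrivial W.direction (insert h S) (Function.update σ h 0) ↔
            A.RecTrivial W.direction S σ := by
          constructor
          · intro H v hv hrec i hi
            have := H (v + (-A.lin h v / A.lin h l) • l)
              (W.direction.add_mem hv (W.direction.smul_mem _ hlD.1))
              ((isRec_insert hS).2 ⟨Or.inl ?_, fun j hj => ?_⟩) i (Finset.mem_insert_of_mem hi)
            · rwa [map_add, map_smul, hlD.2 i hi, smul_zero, add_zero] at this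
            · rw [map_add, map_smul, smul_eq_mul]
              field_simp
              ring
            · rw [map_add, map_smul, hlD.2 j hj, smul_zero, add_zero]
              exact hrec j hj
          · intro H v hv hrec
            rw [isRec_insert hS] at hrec
            rw [Finset.forall_mem_insert]
            exact ⟨hrec.1.elim id fun h => sign_eq_zero_iff.1 h, H v hv hrec.2⟩
        rw [huniv, sum_univ_signType, if_neg h1, if_neg h2, zeroDir_update_zero hσh,
          ← finrank_inf_ker_add_one (A.lin h) hlz hlh, pow_succ]
        simp only [h0]
        split_ifs <;> ring
      rw [Finset.sum_congr rfl key, Finset.sum_neg_distrib, ih, lineality_insert,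
        ← finrank_inf_ker_add_one (A.lin h) hl hlh, pow_succ]
      ring

end SignVectors

/-! ### The intersection lattice and its rank function -/

section Lattice

variable {n m : ℕ} (A : HyperplaneArrangement n m)

/-- The affine subspace underlying an element of `L ∪ {0̂}`; the value at `0̂` plays no role. -/
def flatOf (y : WithBot A.IntersectionLattice) : AffineSubspace ℝ (EuclideanSpace ℝ (Fin n)) :=
  WithBot.recBotCoe ⊤ (fun w => OrderDual.ofDual w.1) y

/-- The intersection of the hyperplanes indexed by `S`, as an element of `L ∪ {0̂}`. -/
def mkFlat (S : Set (Fin m)) : WithBot A.IntersectionLattice :=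
  WithBot.some (show A.IntersectionLattice from ⟨OrderDual.toDual (A.flat S), S, rfl⟩)

/-- The dimension of the affine subspace `A.flatOf y`. -/
def flatDim (y : WithBot A.IntersectionLattice) : ℕ :=
  Module.finrank ℝ (A.flatOf y).direction

variable {A} {S : Finset (Fin m)} {σ : Fin m → SignType} {p v : EuclideanSpace ℝ (Fin n)}
  {w y X Y : WithBot A.IntersectionLattice} {i : Fin m} {T T' : Set (Fin m)}

theorem flatOf_mkFlat (T : Set (Fin m)) : A.flatOf (A.mkFlat T) = A.flat T := rfl

theorem mkFlat_ne_bot (T : Set (Fin m)) : A.mkFlat T ≠ ⊥ := WithBot.coe_ne_bot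

theorem exists_eq_mkFlat (hy : y ≠ ⊥) : ∃ T, y = A.mkFlat T := by
  obtain ⟨⟨_, T, rfl⟩, rfl⟩ := WithBot.ne_bot_iff_exists.1 hy
  exact ⟨T, rfl⟩

theorem flat_anti (h : T ⊆ T') : A.flat T' ≤ A.flat T := fun _ hx =>
  A.mem_flat.2 fun i hi => A.mem_flat.1 hx i (h hi)

theorem mkFlat_le_mkFlat : A.mkFlat T ≤ A.mkFlat T' ↔ A.flat T' ≤ A.flat T :=
  WithBot.coe_le_coe

theorem le_iff_flatOf_le (hw : w ≠ ⊥) (hy : y ≠ ⊥) : w ≤ y ↔ A.flatOf y ≤ A.flatOf w := by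
  obtain ⟨T, rfl⟩ := exists_eq_mkFlat hw
  obtain ⟨T', rfl⟩ := exists_eq_mkFlat hy
  exact mkFlat_le_mkFlat

theorem eq_of_flatOf_eq (hw : w ≠ ⊥) (hy : y ≠ ⊥) (h : A.flatOf w = A.flatOf y) : w = y :=
  le_antisymm ((le_iff_flatOf_le hw hy).2 h.ge) ((le_iff_flatOf_le hy hw).2 h.le)

theorem flatOf_lt (hw : w ≠ ⊥) (h : w < y) : A.flatOf y < A.flatOf w := by
  have hy : y ≠ ⊥ := (bot_le.trans_lt h).ne'
  exact lt_of_le_not_ge ((le_iff_flatOf_le hw hy).1 h.le)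
    fun h' => h.not_ge ((le_iff_flatOf_le hy hw).2 h')

theorem top_eq_mkFlat : (⊤ : WithBot A.IntersectionLattice) = A.mkFlat Set.univ := rfl

theorem mem_direction_flat (hp : p ∈ A.flat T) :
    v ∈ (A.flat T).direction ↔ ∀ i ∈ T, A.lin i v = 0 := by
  rw [← AffineSubspace.vadd_mem_iff_mem_direction v hp, vadd_eq_add, add_comm, mem_flat]
  refine forall₂_congr fun i hi => ?_
  rw [form_add, A.mem_flat.1 hp i hi, zero_add]

theorem flatOf_top (hnc : A.IsNonCentral) : A.flatOf ⊤ = ⊥ := by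
  rw [top_eq_mkFlat, flatOf_mkFlat, ← AffineSubspace.coe_eq_bot_iff, ← hnc]
  ext x
  simp [mem_flat, mem_hyperplane]

theorem flatOf_eq_bot_iff (hnc : A.IsNonCentral) (hy : y ≠ ⊥) : A.flatOf y = ⊥ ↔ y = ⊤ := by
  constructor
  · intro h
    exact eq_of_flatOf_eq hy top_ne_bot (h.trans (flatOf_top hnc).symm)
  · rintro rfl
    exact flatOf_top hnc

theorem eq_zero_of_lin_eq_zero (hess : A.IsEssential) (h : ∀ i, A.lin i v = 0) : v = 0 := by
  have h1 : Submodule.span ℝ (Set.range A.normal) ≤ LinearMap.ker (innerₛₗ ℝ v) := by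
    rw [Submodule.span_le]
    rintro _ ⟨i, rfl⟩
    rw [SetLike.mem_coe, LinearMap.mem_ker]
    rw [innerₛₗ_apply_apply, real_inner_comm]
    exact h i
  rw [hess, top_le_iff] at h1
  have : v ∈ LinearMap.ker (innerₛₗ ℝ v) := h1 ▸ Submodule.mem_top
  exact inner_self_eq_zero.1 (LinearMap.mem_ker.1 this)

theorem flat_insert : A.flat (insert i T) = A.flat T ⊓ A.hyperplane i := by
  ext x
  simp [mem_flat, AffineSubspace.mem_inf_iff, mem_hyperplane, and_comm]

theorem direction_flat_insert (hp : p ∈ A.flat (insert i T)) :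
    (A.flat (insert i T)).direction = (A.flat T).direction ⊓ LinearMap.ker (A.lin i) := by
  ext v
  rw [mem_direction_flat hp, Submodule.mem_inf,
    mem_direction_flat (flat_anti (Set.subset_insert i T) hp), LinearMap.mem_ker]
  simp [and_comm]

/-- Cutting a flat with one more hyperplane lowers its dimension by at most one, so that each step
down in dimension is realized in the lattice. -/
theorem le_height_mkFlat (S : Finset (Fin m)) (hp : p ∈ A.flat (S : Set (Fin m))) :
    ((n + 1 - A.flatDim (A.mkFlat S) : ℕ) : ℕ∞) ≤ Order.height (A.mkFlat (S : Set (Fin m))) := by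
  induction S using Finset.induction_on with
  | empty =>
    have h1 : A.flatDim (A.mkFlat ((∅ : Finset (Fin m)) : Set (Fin m))) = n := by
      have : A.flat ((∅ : Finset (Fin m)) : Set (Fin m)) = ⊤ := by
        ext x; simp [mem_flat]
      rw [flatDim, flatOf_mkFlat, this, AffineSubspace.direction_top, finrank_top,
        finrank_euclideanSpace_fin]
    rw [h1, Nat.add_sub_cancel_left]
    simpa using Order.height_add_one_le (bot_lt_iff_ne_bot.2 (mkFlat_ne_bot (A := A) _))
  | insert i S hi ih =>
    rw [Finset.coe_insert] at hp ⊢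
    have hp' := flat_anti (A := A) (Set.subset_insert i (S : Set (Fin m))) hp
    have ih := ih hp'
    by_cases hv : ∃ v ∈ (A.flat (S : Set (Fin m))).direction, A.lin i v ≠ 0
    · obtain ⟨v, hv, hvi⟩ := hv
      have h1 : A.flatDim (A.mkFlat (insert i (S : Set (Fin m)))) + 1 =
          A.flatDim (A.mkFlat (S : Set (Fin m))) := by
        rw [flatDim, flatDim, flatOf_mkFlat, flatOf_mkFlat, direction_flat_insert hp]
        exact finrank_inf_ker_add_one (A.lin i) hv hvi
      have hlt : A.mkFlat (S : Set (Fin m)) < A.mkFlat (insert i (S : Set (Fin m))) := by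
        refine lt_of_le_of_ne (mkFlat_le_mkFlat.2 (flat_anti (Set.subset_insert _ _))) ?_
        intro h
        rw [← h] at h1
        omega
      refine le_trans ?_ (Order.height_add_one_le hlt)
      refine le_trans ?_ (add_le_add_left ih 1)
      rw [← h1]
      norm_cast
      omega
    · push Not at hv
      have : A.mkFlat (insert i (S : Set (Fin m))) = A.mkFlat (S : Set (Fin m)) := by
        refine le_antisymm (mkFlat_le_mkFlat.2 fun x hx => ?_)
          (mkFlat_le_mkFlat.2 (flat_anti (Set.subset_insert _ _)))
        rw [flat_insert, AffineSubspace.mem_inf_iff]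
        refine ⟨hx, A.mem_hyperplane.2 ?_⟩
        have h0 := hv _ (sub_mem_direction hp' hx)
        rwa [lin_sub, A.mem_flat.1 hp i (Set.mem_insert _ _), sub_zero] at h0
      rw [this]
      exact ih

theorem flatDim_le (y : WithBot A.IntersectionLattice) : A.flatDim y ≤ n := by
  have := Submodule.finrank_le (A.flatOf y).direction
  rwa [finrank_euclideanSpace_fin] at this

/-- A minimal nonempty flat of an essential arrangement is a point. -/
theorem exists_flatDim_eq_zero (hess : A.IsEssential) :
    ∃ S : Finset (Fin m), (∃ p, p ∈ A.flat (S : Set (Fin m))) ∧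
      A.flatDim (A.mkFlat (S : Set (Fin m))) = 0 := by
  have key : ∀ d, ∀ S : Finset (Fin m), (∃ p, p ∈ A.flat (S : Set (Fin m))) →
      A.flatDim (A.mkFlat (S : Set (Fin m))) = d →
      ∃ S : Finset (Fin m), (∃ p, p ∈ A.flat (S : Set (Fin m))) ∧
        A.flatDim (A.mkFlat (S : Set (Fin m))) = 0 := by
    intro d
    induction d with
    | zero => exact fun S h1 h2 => ⟨S, h1, h2⟩
    | succ d ih =>
      rintro S ⟨p, hp⟩ hd
      have hne : (A.flat (S : Set (Fin m))).direction ≠ ⊥ := by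
        intro h
        rw [flatDim, flatOf_mkFlat, h, finrank_bot] at hd
        omega
      obtain ⟨v, hv, hv0⟩ := Submodule.exists_mem_ne_zero_of_ne_bot hne
      obtain ⟨i, hi⟩ : ∃ i, A.lin i v ≠ 0 := by
        by_contra! h
        exact hv0 (eq_zero_of_lin_eq_zero hess h)
      have hq : p + (-A.form i p / A.lin i v) • v ∈ A.flat (insert i (S : Set (Fin m))) := by
        rw [flat_insert, AffineSubspace.mem_inf_iff]
        refine ⟨add_smul_mem hp hv _, A.mem_hyperplane.2 ?_⟩
        rw [form_add_smul]
        field_simp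
        ring
      refine ih (insert i S) ⟨_, by rwa [Finset.coe_insert]⟩ ?_
      rw [Finset.coe_insert, flatDim, flatOf_mkFlat, direction_flat_insert hq]
      have := finrank_inf_ker_add_one (A.lin i) hv hi
      rw [flatDim, flatOf_mkFlat] at hd
      omega
  exact key _ ∅ ⟨0, by simp [mem_flat]⟩ rfl

variable (A) in
/-- The rank function of `L ∪ {0̂}` in terms of dimensions: a nonempty flat has rank `n + 1` minus
its dimension, and the empty flat has the rank of a flat of dimension `-1`. -/
def level (y : WithBot A.IntersectionLattice) : ℕ :=
  if y = ⊥ then 0 else if A.flatOf y = ⊥ then n + 2 else n + 1 - A.flatDim y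

theorem level_strictMono : StrictMono A.level := by
  intro w y h
  have hy : y ≠ ⊥ := (bot_le.trans_lt h).ne'
  have hdy := flatDim_le y
  have hdw := flatDim_le w
  by_cases hw : w = ⊥
  · simp only [level, if_pos hw, if_neg hy]
    split_ifs <;> omega
  have hlt := flatOf_lt hw h
  have hwb : A.flatOf w ≠ ⊥ := (bot_le.trans_lt hlt).ne'
  simp only [level, if_neg hw, if_neg hy, if_neg hwb]
  split_ifs with hyb
  · omega
  · have := Submodule.finrank_lt_finrank_of_lt (AffineSubspace.direction_lt_of_nonempty hlt
      ((AffineSubspace.nonempty_iff_ne_bot _).2 hyb))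
    simp only [flatDim] at *
    omega

theorem height_eq_level (hess : A.IsEssential) (hnc : A.IsNonCentral)
    (y : WithBot A.IntersectionLattice) : Order.height y = A.level y := by
  refine le_antisymm ?_ ?_
  · have := Order.height_le_height_apply_of_strictMono _ (level_strictMono (A := A)) y
    rwa [Order.height_nat] at this
  · by_cases hy : y = ⊥
    · simp [level, hy]
    · obtain ⟨T, rfl⟩ := exists_eq_mkFlat hy
      by_cases hb : A.flatOf (A.mkFlat T) = ⊥
      · obtain ⟨S, ⟨p, hp⟩, hS⟩ := exists_flatDim_eq_zero hess
        have h1 := le_height_mkFlat S hp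
        have hlt : A.mkFlat (S : Set (Fin m)) < A.mkFlat T := by
          rw [(flatOf_eq_bot_iff hnc hy).1 hb]
          refine lt_top_iff_ne_top.2 fun h => ?_
          rw [← flatOf_eq_bot_iff hnc (mkFlat_ne_bot _)] at h
          rw [flatOf_mkFlat] at h
          rw [h] at hp
          exact AffineSubspace.notMem_bot ℝ _ p hp
        rw [level, if_neg hy, if_pos hb]
        refine le_trans ?_ (Order.height_add_one_le hlt)
        refine le_trans ?_ (add_le_add_left h1 1)
        rw [hS]
        norm_cast
      · obtain ⟨p, hp⟩ := (AffineSubspace.nonempty_iff_ne_bot _).2 hb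
        rw [level, if_neg hy, if_neg hb]
        have := le_height_mkFlat (p := p) (A := A) T.toFinset
          (by rw [Set.coe_toFinset]; exact hp)
        simpa using this

theorem rk_eq_level (hess : A.IsEssential) (hnc : A.IsNonCentral)
    (y : WithBot A.IntersectionLattice) : rk y = A.level y := by
  rw [rk, height_eq_level hess hnc, ENat.toNat_natCast]

theorem neg_one_pow_rk_sub (hess : A.IsEssential) (hnc : A.IsNonCentral) (hX : X ≠ ⊥)
    (hXw : X ≤ w) (hw : A.flatOf w ≠ ⊥) :
    (-1 : ℤ) ^ (rk w - rk X) = (-1) ^ A.flatDim X * (-1) ^ A.flatDim w := by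
  have hw' : w ≠ ⊥ := (lt_of_lt_of_le (bot_lt_iff_ne_bot.2 hX) hXw).ne'
  have hle := (le_iff_flatOf_le hX hw').1 hXw
  have hXb : A.flatOf X ≠ ⊥ := fun h => hw (le_bot_iff.1 (h ▸ hle))
  have hd : A.flatDim w ≤ A.flatDim X := Submodule.finrank_mono (AffineSubspace.direction_le hle)
  have hX' := flatDim_le X
  rw [rk_eq_level hess hnc, rk_eq_level hess hnc]
  simp only [level, if_neg hX, if_neg hw', if_neg hw, if_neg hXb]
  rw [← pow_add]
  have : A.flatDim X + A.flatDim w =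
      (n + 1 - A.flatDim w - (n + 1 - A.flatDim X)) + 2 * A.flatDim w := by omega
  rw [this, pow_add, pow_mul]
  simp

theorem neg_one_pow_rk_top_sub (hess : A.IsEssential) (hnc : A.IsNonCentral) (hX : X ≠ ⊥)
    (hXb : A.flatOf X ≠ ⊥) :
    (-1 : ℤ) ^ (rk (⊤ : WithBot A.IntersectionLattice) - rk X) = -(-1) ^ A.flatDim X := by
  have hX' := flatDim_le X
  rw [rk_eq_level hess hnc, rk_eq_level hess hnc]
  simp only [level, if_neg hX, if_neg hXb, if_neg top_ne_bot, if_pos (flatOf_top hnc)]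
  have : n + 2 - (n + 1 - A.flatDim X) = A.flatDim X + 1 := by omega
  rw [this, pow_succ]
  ring

/-! ### Counting cells with a given affine hull -/

variable (A) in
/-- The hyperplanes that contain the flat `Y`; all of them if `Y` is empty. -/
def localIdx (Y : WithBot A.IntersectionLattice) : Finset (Fin m) :=
  {i | A.flatOf Y ≤ A.hyperplane i}

variable (A) in
/-- The affine hull of the cell with sign vector `σ`. -/
def zeroFlat (σ : Fin m → SignType) : WithBot A.IntersectionLattice := A.mkFlat {i | σ i = 0}

variable (A) in
/-- The cells with affine hull `X` of the arrangement formed by the hyperplanes that contain `Y`. -/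
def localCells (Y X : WithBot A.IntersectionLattice) : Finset (Fin m → SignType) :=
  {σ ∈ A.cells ⊤ (A.localIdx Y) | A.zeroFlat σ = X}

theorem mem_localIdx : i ∈ A.localIdx Y ↔ A.flatOf Y ≤ A.hyperplane i := by simp [localIdx]

theorem mem_localCells : σ ∈ A.localCells Y X ↔
    (∃ p, A.signs (A.localIdx Y) p = σ) ∧ A.zeroFlat σ = X := by
  simp [localCells, mem_cells]

theorem zeroFlat_le (hY : Y ≠ ⊥) (p : EuclideanSpace ℝ (Fin n)) :
    A.zeroFlat (A.signs (A.localIdx Y) p) ≤ Y := by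
  refine (le_iff_flatOf_le (mkFlat_ne_bot _) hY).2 fun x hx => A.mem_flat.2 fun i hi => ?_
  exact A.mem_hyperplane.1 (mem_localIdx.1 (signs_eq_zero.1 hi).1 hx)

theorem mem_flat_zeroFlat (p : EuclideanSpace ℝ (Fin n)) :
    p ∈ A.flatOf (A.zeroFlat (A.signs S p)) :=
  A.mem_flat.2 fun _ hi => (signs_eq_zero.1 hi).2

theorem le_zeroFlat_iff (hw : w ≠ ⊥) (hY : Y ≠ ⊥) (hwY : w ≤ Y) :
    w ≤ A.zeroFlat (A.signs (A.localIdx Y) p) ↔ p ∈ A.flatOf w := by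
  rw [le_iff_flatOf_le hw (show A.zeroFlat _ ≠ ⊥ from mkFlat_ne_bot _)]
  refine ⟨fun h => h (mem_flat_zeroFlat p), fun hp => ?_⟩
  have hle := (le_iff_flatOf_le hw hY).1 hwY
  obtain ⟨T, rfl⟩ := exists_eq_mkFlat hw
  refine flat_anti fun i hi => signs_eq_zero.2 ⟨mem_localIdx.2 fun x hx => ?_, ?_⟩
  · exact A.mem_hyperplane.2 (A.mem_flat.1 (hle hx) i hi)
  · exact A.mem_flat.1 hp i hi

/-- The cells of the flat `w` are the cells whose affine hull is contained in `w`. -/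
theorem sum_cells_flatOf (hw : w ≠ ⊥) (hwY : w ≤ Y) (g : (Fin m → SignType) → ℤ) :
    ∑ σ ∈ A.cells (A.flatOf w) (A.localIdx Y), g σ =
      ∑ y ∈ Finset.Icc w Y, ∑ σ ∈ A.localCells Y y, g σ := by
  have hY : Y ≠ ⊥ := (lt_of_lt_of_le (bot_lt_iff_ne_bot.2 hw) hwY).ne'
  have hmaps : ∀ σ ∈ A.cells (A.flatOf w) (A.localIdx Y), A.zeroFlat σ ∈ Finset.Icc w Y := by
    intro σ hσ
    obtain ⟨p, hp, rfl⟩ := mem_cells.1 hσ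
    exact Finset.mem_Icc.2 ⟨(le_zeroFlat_iff hw hY hwY).2 hp, zeroFlat_le hY p⟩
  rw [← Finset.sum_fiberwise_of_maps_to hmaps]
  refine Finset.sum_congr rfl fun y hy => Finset.sum_congr ?_ fun _ _ => rfl
  ext σ
  rw [Finset.mem_filter, mem_localCells, mem_cells]
  refine and_congr_left ?_
  rintro rfl
  constructor
  · rintro ⟨p, -, rfl⟩; exact ⟨p, rfl⟩
  · rintro ⟨p, rfl⟩
    exact ⟨p, (le_zeroFlat_iff hw hY hwY).1 (Finset.mem_Icc.1 hy).1, rfl⟩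

theorem zeroDir_direction_flatOf (hw : w ≠ ⊥) (hwY : w ≤ Y) (hp : p ∈ A.flatOf w) :
    A.zeroDir (A.flatOf w).direction (A.signs (A.localIdx Y) p) =
      (A.flatOf (A.zeroFlat (A.signs (A.localIdx Y) p))).direction := by
  have hY : Y ≠ ⊥ := (lt_of_lt_of_le (bot_lt_iff_ne_bot.2 hw) hwY).ne'
  have hle := (le_iff_flatOf_le hw (mkFlat_ne_bot _)).1 ((le_zeroFlat_iff hw hY hwY).2 hp)
  ext v
  rw [mem_zeroDir, zeroFlat, flatOf_mkFlat, mem_direction_flat (mem_flat_zeroFlat p)]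
  refine ⟨fun h => h.2, fun h => ⟨AffineSubspace.direction_le hle ?_, h⟩⟩
  exact (mem_direction_flat (mem_flat_zeroFlat p)).2 h

theorem cells_bot : A.cells ⊥ S = ∅ := by
  ext σ
  simp [mem_cells, AffineSubspace.notMem_bot]

theorem sum_Icc_neg_one_pow_mul_card (hw : w ≠ ⊥) (hwY : w ≤ Y) :
    ∑ y ∈ Finset.Icc w Y, (-1 : ℤ) ^ A.flatDim y * (A.localCells Y y).card =
      if A.flatOf w = ⊥ then 0 else (-1) ^ A.flatDim w := by
  have h1 : ∀ y, (-1 : ℤ) ^ A.flatDim y * (A.localCells Y y).card =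
      ∑ σ ∈ A.localCells Y y, (-1 : ℤ) ^ A.flatDim (A.zeroFlat σ) := by
    intro y
    rw [Finset.sum_congr rfl fun σ hσ => by rw [(mem_localCells.1 hσ).2], Finset.sum_const,
      nsmul_eq_mul, mul_comm]
  simp_rw [h1]
  rw [← sum_cells_flatOf hw hwY]
  split_ifs with hb
  · rw [hb, cells_bot, Finset.sum_empty]
  · obtain ⟨p, hp⟩ := (AffineSubspace.nonempty_iff_ne_bot _).2 hb
    rw [flatDim, ← sum_cells_neg_one_pow hp (A.localIdx Y)]
    refine Finset.sum_congr rfl fun σ hσ => ?_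
    obtain ⟨q, hq, rfl⟩ := mem_cells.1 hσ
    rw [zeroDir_direction_flatOf hw hwY hq, flatDim]

/-- Zaslavsky's count in central form: Möbius inversion of Euler's relation. -/
theorem card_localCells (hess : A.IsEssential) (hnc : A.IsNonCentral) (hX : X ≠ ⊥) (hXY : X ≤ Y)
    (hY : A.flatOf Y ≠ ⊥) : ((A.localCells Y X).card : ℤ) = zaslavsky X Y := by
  have h := eq_sum_mu_mul_of_sum_Icc hXY
    (f := fun y => (-1 : ℤ) ^ A.flatDim y * (A.localCells Y y).card)
    (g := fun w => if A.flatOf w = ⊥ then 0 else (-1) ^ A.flatDim w) (by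
      intro w hw
      rw [Finset.mem_Icc] at hw
      exact (sum_Icc_neg_one_pow_mul_card
        (lt_of_lt_of_le (bot_lt_iff_ne_bot.2 hX) hw.1).ne' hw.2).symm)
  have hsq : (-1 : ℤ) ^ A.flatDim X * (-1) ^ A.flatDim X = 1 := by
    rw [← mul_pow]; simp
  calc ((A.localCells Y X).card : ℤ)
      = (-1) ^ A.flatDim X * ((-1 : ℤ) ^ A.flatDim X * (A.localCells Y X).card) := by
        rw [← mul_assoc, hsq, one_mul]
    _ = zaslavsky X Y := by
      rw [h, zaslavsky, Finset.mul_sum]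
      refine Finset.sum_congr rfl fun w hw => ?_
      rw [Finset.mem_Icc] at hw
      have hw0 : w ≠ ⊥ := (lt_of_lt_of_le (bot_lt_iff_ne_bot.2 hX) hw.1).ne'
      have hwb : A.flatOf w ≠ ⊥ := by
        intro e
        have hY0 : Y ≠ ⊥ := (lt_of_lt_of_le (bot_lt_iff_ne_bot.2 hX) hXY).ne'
        exact hY (le_bot_iff.1 (e ▸ (le_iff_flatOf_le hw0 hY0).1 hw.2))
      rw [if_neg hwb, neg_one_pow_rk_sub hess hnc hX hw.1 hwb]
      ring

theorem card_localCells_top (hess : A.IsEssential) (hnc : A.IsNonCentral) (hX : X ≠ ⊥) :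
    ((A.localCells ⊤ X).card : ℤ) = zaslavsky X ⊤ - zaslavskyBounded X ⊤ := by
  have h := eq_sum_mu_mul_of_sum_Icc (le_top : X ≤ ⊤)
    (f := fun y => (-1 : ℤ) ^ A.flatDim y * (A.localCells ⊤ y).card)
    (g := fun w => if A.flatOf w = ⊥ then 0 else (-1) ^ A.flatDim w) (by
      intro w hw
      rw [Finset.mem_Icc] at hw
      exact (sum_Icc_neg_one_pow_mul_card
        (lt_of_lt_of_le (bot_lt_iff_ne_bot.2 hX) hw.1).ne' hw.2).symm)
  have hsq : (-1 : ℤ) ^ A.flatDim X * (-1) ^ A.flatDim X = 1 := by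
    rw [← mul_pow]; simp
  have htop : (⊤ : WithBot A.IntersectionLattice) ∈ Finset.Icc X ⊤ :=
    Finset.mem_Icc.2 ⟨le_top, le_rfl⟩
  calc ((A.localCells ⊤ X).card : ℤ)
      = (-1) ^ A.flatDim X * ((-1 : ℤ) ^ A.flatDim X * (A.localCells ⊤ X).card) := by
        rw [← mul_assoc, hsq, one_mul]
    _ = zaslavsky X ⊤ - zaslavskyBounded X ⊤ := by
      rw [h, zaslavsky, zaslavskyBounded, ← Finset.sum_erase_add _ _ htop,
        ← Finset.sum_erase_add (Finset.Icc X ⊤) _ htop, if_pos (flatOf_top hnc), mul_zero,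
        add_zero, add_sub_cancel_right, Finset.mul_sum]
      refine Finset.sum_congr rfl fun w hw => ?_
      rw [Finset.mem_erase, Finset.mem_Icc] at hw
      have hw0 : w ≠ ⊥ := (lt_of_lt_of_le (bot_lt_iff_ne_bot.2 hX) hw.2.1).ne'
      have hwb : A.flatOf w ≠ ⊥ := fun e => hw.1 ((flatOf_eq_bot_iff hnc hw0).1 e)
      rw [if_neg hwb, neg_one_pow_rk_sub hess hnc hX hw.2.1 hwb]
      ring

theorem localIdx_top (hnc : A.IsNonCentral) : A.localIdx ⊤ = Finset.univ := by
  ext i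
  simp [mem_localIdx, flatOf_top hnc]

theorem recTrivial_direction_flatOf (hnc : A.IsNonCentral) (hw : w ≠ ⊥) (hp : p ∈ A.flatOf w) :
    A.RecTrivial (A.flatOf w).direction (A.localIdx ⊤) (A.signs (A.localIdx ⊤) p) ↔
      A.RecTrivial ⊤ (A.localIdx ⊤) (A.signs (A.localIdx ⊤) p) := by
  refine ⟨fun H v _ hv => H v ?_ hv, fun H v _ hv => H v Submodule.mem_top hv⟩
  obtain ⟨T, rfl⟩ := exists_eq_mkFlat hw
  refine (mem_direction_flat hp).2 fun i hi => ?_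
  have hmem : i ∈ A.localIdx ⊤ := by rw [localIdx_top hnc]; exact Finset.mem_univ i
  refine (hv i hmem).elim id fun h => ?_
  rw [signs_of_mem hmem, A.mem_flat.1 hp i hi, sign_zero] at h
  exact sign_eq_zero_iff.1 h

theorem sum_Icc_neg_one_pow_mul_card_recTrivial (hess : A.IsEssential) (hnc : A.IsNonCentral)
    (hw : w ≠ ⊥) :
    ∑ y ∈ Finset.Icc w ⊤, (-1 : ℤ) ^ A.flatDim y *
        ({σ ∈ A.localCells ⊤ y | A.RecTrivial ⊤ (A.localIdx ⊤) σ}.card : ℤ) =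
      if A.flatOf w = ⊥ then 0 else 1 := by
  have h1 : ∀ y, (-1 : ℤ) ^ A.flatDim y *
        ({σ ∈ A.localCells ⊤ y | A.RecTrivial ⊤ (A.localIdx ⊤) σ}.card : ℤ) =
      ∑ σ ∈ A.localCells ⊤ y, if A.RecTrivial ⊤ (A.localIdx ⊤) σ then
        (-1 : ℤ) ^ A.flatDim (A.zeroFlat σ) else 0 := by
    intro y
    rw [← Finset.sum_filter, Finset.sum_congr rfl fun σ hσ => by
      rw [(mem_localCells.1 (Finset.mem_filter.1 hσ).1).2], Finset.sum_const,
      nsmul_eq_mul, mul_comm]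
  simp_rw [h1]
  rw [← sum_cells_flatOf hw le_top]
  split_ifs with hb
  · rw [hb, cells_bot, Finset.sum_empty]
  · obtain ⟨p, hp⟩ := (AffineSubspace.nonempty_iff_ne_bot _).2 hb
    have hlin : A.lineality (A.flatOf w).direction (A.localIdx ⊤) = ⊥ := by
      rw [eq_bot_iff]
      intro v hv
      rw [mem_lineality, localIdx_top hnc] at hv
      exact (Submodule.mem_bot ℝ).2
        (eq_zero_of_lin_eq_zero hess fun i => hv.2 i (Finset.mem_univ i))
    have h2 := sum_cells_recTrivial_neg_one_pow (A := A) hp (A.localIdx ⊤)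
    rw [hlin, finrank_bot, pow_zero] at h2
    refine Eq.trans ?_ h2
    refine Finset.sum_congr rfl fun σ hσ => ?_
    obtain ⟨q, hq, rfl⟩ := mem_cells.1 hσ
    rw [zeroDir_direction_flatOf hw le_top hq, flatDim]
    simp only [recTrivial_direction_flatOf hnc hw hq]

/-- Zaslavsky's count of bounded cells: Möbius inversion of Euler's relation for bounded cells. -/
theorem card_localCells_recTrivial (hess : A.IsEssential) (hnc : A.IsNonCentral) (hX : X ≠ ⊥)
    (hXb : A.flatOf X ≠ ⊥) :
    ({σ ∈ A.localCells ⊤ X | A.RecTrivial ⊤ (A.localIdx ⊤) σ}.card : ℤ) =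
      zaslavskyBounded X ⊤ := by
  have hX1 : X < ⊤ := lt_top_iff_ne_top.2 fun e => hXb ((flatOf_eq_bot_iff hnc hX).2 e)
  have h := eq_neg_mu_of_sum_Icc_eq_one hX1
    (f := fun y => (-1 : ℤ) ^ A.flatDim y *
      ({σ ∈ A.localCells ⊤ y | A.RecTrivial ⊤ (A.localIdx ⊤) σ}.card : ℤ)) (by
      have := sum_Icc_neg_one_pow_mul_card_recTrivial hess hnc (top_ne_bot)
      rwa [Finset.Icc_self, Finset.sum_singleton, if_pos (flatOf_top hnc)] at this) (by
      intro w hw hw1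
      have hw0 : w ≠ ⊥ := (lt_of_lt_of_le (bot_lt_iff_ne_bot.2 hX) (Finset.mem_Icc.1 hw).1).ne'
      rw [sum_Icc_neg_one_pow_mul_card_recTrivial hess hnc hw0,
        if_neg fun e => hw1 ((flatOf_eq_bot_iff hnc hw0).1 e)])
  have hsq : (-1 : ℤ) ^ A.flatDim X * (-1) ^ A.flatDim X = 1 := by
    rw [← mul_pow]; simp
  rw [zaslavskyBounded, neg_one_pow_rk_top_sub hess hnc hX hXb]
  linear_combination (-1 : ℤ) ^ A.flatDim X * h -
    ({σ ∈ A.localCells ⊤ X | A.RecTrivial ⊤ (A.localIdx ⊤) σ}.card : ℤ) * hsq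

theorem card_localCells_not_recTrivial (hess : A.IsEssential) (hnc : A.IsNonCentral)
    (hX : X ≠ ⊥) (hXb : A.flatOf X ≠ ⊥) :
    ({σ ∈ A.localCells ⊤ X | ¬ A.RecTrivial ⊤ (A.localIdx ⊤) σ}.card : ℤ) =
      zaslavskyUnbounded X ⊤ := by
  have h1 := card_localCells_top hess hnc hX
  have h2 := card_localCells_recTrivial hess hnc hX hXb
  have h3 := Finset.card_filter_add_card_filter_not (s := A.localCells ⊤ X)
    (A.RecTrivial ⊤ (A.localIdx ⊤))
  rw [zaslavskyUnbounded]
  zify at h3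
  linarith

end Lattice

section Faces

variable {n m : ℕ} {A : HyperplaneArrangement n m} {p q : EuclideanSpace ℝ (Fin n)}
  {X Y : WithBot A.IntersectionLattice}

/-! ### Faces and sign vectors -/

theorem mem_closure_cell : q ∈ closure (A.cell p) ↔
    ∀ i, A.form i q = 0 ∨ SignType.sign (A.form i q) = SignType.sign (A.form i p) := by
  constructor
  · have hcl : IsClosed {q | ∀ i, A.form i q = 0 ∨
        SignType.sign (A.form i q) = SignType.sign (A.form i p)} := by
      rw [Set.ofPred_forall]
      refine isClosed_iInter fun i => ?_
      have hc := A.continuous_form i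
      rcases lt_trichotomy (A.form i p) 0 with h | h | h
      · convert isClosed_le hc continuous_const using 3 with q
        rw [sign_neg h, sign_eq_neg_one_iff, le_iff_eq_or_lt]
      · convert isClosed_eq hc continuous_const using 3 with q
        rw [h, sign_zero, sign_eq_zero_iff, or_self]
      · convert isClosed_le continuous_const hc using 3 with q
        rw [sign_pos h, sign_eq_one_iff, le_iff_eq_or_lt, eq_comm]
    have hsub : A.cell p ⊆ {q | ∀ i, A.form i q = 0 ∨
        SignType.sign (A.form i q) = SignType.sign (A.form i p)} := fun q hq i => Or.inr (hq i)
    exact fun h => closure_minimal hsub hcl h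
  · intro hq
    have hcont : Continuous fun t : ℝ => q + t • (p - q) := by fun_prop
    have ht : Filter.Tendsto (fun t : ℝ => q + t • (p - q)) (nhdsWithin 0 (Set.Ioi 0))
        (nhds q) := by
      have := hcont.tendsto 0
      rw [zero_smul, add_zero] at this
      exact this.mono_left nhdsWithin_le_nhds
    refine mem_closure_of_tendsto ht ?_
    have h1 : ∀ᶠ t : ℝ in nhdsWithin 0 (Set.Ioi 0), t < 1 :=
      nhdsWithin_le_nhds (Iio_mem_nhds one_pos)
    filter_upwards [self_mem_nhdsWithin, h1] with t (ht0 : 0 < t) ht1 i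
    rw [form_add_smul, lin_sub]
    rcases hq i with h | h
    · rw [h, zero_add, sub_zero, sign_mul, sign_pos ht0, one_mul]
    · rcases lt_trichotomy (A.form i p) 0 with h' | h' | h'
      · rw [sign_neg h', sign_eq_neg_one_iff] at h
        rw [sign_neg h']
        exact sign_neg (by nlinarith)
      · rw [h', sign_zero, sign_eq_zero_iff] at h
        rw [h', h]; simp
      · rw [sign_pos h', sign_eq_one_iff] at h
        rw [sign_pos h']
        exact sign_pos (by nlinarith)

theorem mem_closure_cell_self (p : EuclideanSpace ℝ (Fin n)) : p ∈ closure (A.cell p) :=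
  subset_closure fun _ => rfl

theorem closure_cell_subset : closure (A.cell p) ⊆ closure (A.cell q) ↔ p ∈ closure (A.cell q) := by
  refine ⟨fun h => h (mem_closure_cell_self p), fun h r hr => ?_⟩
  rw [mem_closure_cell] at *
  intro i
  rcases hr i with h1 | h1
  · exact Or.inl h1
  · rcases h i with h2 | h2
    · rw [h2, sign_zero, sign_eq_zero_iff] at h1
      exact Or.inl h1
    · exact Or.inr (h1.trans h2)

theorem closure_cell_eq : closure (A.cell p) = closure (A.cell q) ↔
    ∀ i, SignType.sign (A.form i p) = SignType.sign (A.form i q) := by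
  constructor
  · intro h i
    have h1 := mem_closure_cell.1 (h ▸ mem_closure_cell_self p) i
    have h2 := mem_closure_cell.1 (h.symm ▸ mem_closure_cell_self q) i
    rcases h1 with h1 | h1
    · rcases h2 with h2 | h2
      · rw [h1, h2]
      · exact h2.symm
    · exact h1
  · intro h
    have : A.cell p = A.cell q := by
      ext r
      exact forall_congr' fun i => by rw [h i]
    rw [this]

theorem affineSpan_closure_cell (p : EuclideanSpace ℝ (Fin n)) :
    affineSpan ℝ (closure (A.cell p)) = A.flat {i | A.form i p = 0} := by
  obtain ⟨S, hS⟩ := A.exists_flat_of_isFace ⟨p, rfl⟩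
  refine le_antisymm (affineSpan_le.2 fun q hq => A.mem_flat.2 fun i (hi : A.form i p = 0) => ?_) ?_
  · refine (mem_closure_cell.1 hq i).elim id fun h => ?_
    rwa [hi, sign_zero, sign_eq_zero_iff] at h
  · rw [hS]
    have hp : p ∈ A.flat S := hS ▸ subset_affineSpan ℝ _ (mem_closure_cell_self p)
    exact flat_anti fun i hi => A.mem_flat.1 hp i hi

/-- In an essential arrangement a face is bounded if and only if it has no recession direction. -/
theorem isBounded_closure_cell_iff (hess : A.IsEssential) :
    Bornology.IsBounded (closure (A.cell p)) ↔
      A.RecTrivial ⊤ Finset.univ (A.signs Finset.univ p) := by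
  constructor
  · intro hb v _ hv
    obtain ⟨C, hC⟩ := hb.exists_norm_le
    by_contra hne
    have hv0 : v ≠ 0 := by
      rintro rfl
      exact hne fun i _ => map_zero _
    have hpos := norm_pos_iff.2 hv0
    have hC0 : 0 ≤ C := (norm_nonneg p).trans (hC p (mem_closure_cell_self p))
    have ht : 0 ≤ (C + ‖p‖ + 1) / ‖v‖ := by positivity
    have h1 := hC (p + ((C + ‖p‖ + 1) / ‖v‖) • v) (subset_closure fun i =>
      signs_eq_signs.1 (signs_add_of_isRec hv ht) i (Finset.mem_univ i))
    have h2 := norm_sub_le (p + ((C + ‖p‖ + 1) / ‖v‖) • v) p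
    rw [add_sub_cancel_left, norm_smul, Real.norm_of_nonneg ht, div_mul_cancel₀ _ hpos.ne'] at h2
    linarith
  · intro hR
    by_contra hb
    -- A limit of the directions from `p` to points tending to infinity is a recession direction.
    have hfar : ∀ k : ℕ, ∃ x ∈ closure (A.cell p), (k : ℝ) + 1 < ‖x - p‖ := by
      intro k
      by_contra! h
      refine hb ((Metric.isBounded_closedBall (x := p) (r := k + 1)).subset fun x hx => ?_)
      rw [Metric.mem_closedBall, dist_eq_norm]
      exact h x hx
    choose x hx hxk using hfar
    have hpos : ∀ k, 0 < ‖x k - p‖ := fun k => lt_trans (by positivity) (hxk k)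
    obtain ⟨u, hu, φ, hφ, hlim⟩ := (isCompact_sphere (0 : EuclideanSpace ℝ (Fin n)) 1).tendsto_subseq
      (x := fun k => ‖x k - p‖⁻¹ • (x k - p)) (fun k => by
        rw [mem_sphere_zero_iff_norm, norm_smul, norm_inv, norm_norm,
          inv_mul_cancel₀ (hpos k).ne'])
    have hinf : Filter.Tendsto (fun k => ‖x (φ k) - p‖) Filter.atTop Filter.atTop := by
      refine Filter.tendsto_atTop_mono (fun k => ?_) tendsto_natCast_atTop_atTop
      have h1 := hxk (φ k)
      have h2 : (k : ℝ) ≤ φ k := by exact_mod_cast hφ.id_le k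
      linarith
    have hform : ∀ i, Filter.Tendsto (fun k => A.form i (x (φ k)) / ‖x (φ k) - p‖) Filter.atTop
        (nhds (A.lin i u)) := by
      intro i
      have hc : Continuous (A.lin i) := LinearMap.continuous_of_finiteDimensional _
      have h1 := ((hc.tendsto u).comp hlim).add (hinf.const_div_atTop (A.form i p))
      rw [add_zero] at h1
      refine h1.congr fun k => ?_
      simp only [Function.comp_apply, map_smul, lin_sub, smul_eq_mul]
      have := (hpos (φ k)).ne'
      field_simp
      ring
    have hrec : A.IsRec Finset.univ (A.signs Finset.univ p) u := by
      intro i hi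
      rw [signs_of_mem hi]
      rcases lt_trichotomy (A.form i p) 0 with h | h | h
      · rw [sign_neg h, sign_eq_neg_one_iff, ← le_iff_eq_or_lt]
        refine le_of_tendsto' (hform i) fun k => div_nonpos_of_nonpos_of_nonneg ?_ (hpos _).le
        have := mem_closure_cell.1 (hx (φ k)) i
        rwa [sign_neg h, sign_eq_neg_one_iff, ← le_iff_eq_or_lt] at this
      · refine Or.inl (tendsto_nhds_unique (hform i) ?_)
        have : ∀ k, A.form i (x (φ k)) = 0 := by
          intro k
          have := mem_closure_cell.1 (hx (φ k)) i
          rwa [h, sign_zero, sign_eq_zero_iff, or_self] at this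
        simp [this]
      · rw [sign_pos h, sign_eq_one_iff, eq_comm, ← le_iff_eq_or_lt]
        refine ge_of_tendsto' (hform i) fun k => div_nonneg ?_ (hpos _).le
        have := mem_closure_cell.1 (hx (φ k)) i
        rwa [sign_pos h, sign_eq_one_iff, eq_comm, ← le_iff_eq_or_lt] at this
    have hu0 := eq_zero_of_lin_eq_zero hess
      fun i => hR u Submodule.mem_top hrec i (Finset.mem_univ i)
    rw [hu0, mem_sphere_zero_iff_norm, norm_zero] at hu
    exact zero_ne_one hu

/-! ### Counting unbounded faces -/

/-- The closure of the cell of `p`, as an element of the poset of unbounded faces. -/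
def unboundedFace (p : EuclideanSpace ℝ (Fin n))
    (hp : ¬ Bornology.IsBounded (closure (A.cell p))) : A.UnboundedPoset :=
  WithTop.some (WithBot.some (OrderDual.toDual
    (show A.UnboundedFace from ⟨closure (A.cell p), ⟨p, rfl⟩, hp⟩)))

theorem eq_top_or_eq_bot_or_exists (a : A.UnboundedPoset) :
    a = ⊤ ∨ a = ⊥ ∨ ∃ p hp, a = unboundedFace p hp := by
  induction a using WithTop.recTopCoe with
  | top => exact Or.inl rfl
  | coe a =>
    induction a using WithBot.recBotCoe with
    | bot => exact Or.inr (Or.inl rfl)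
    | coe F =>
      obtain ⟨_, ⟨p, rfl⟩, hp⟩ := F
      exact Or.inr (Or.inr ⟨p, hp, rfl⟩)

theorem unboundedFace_le {hp : ¬ Bornology.IsBounded (closure (A.cell p))}
    {hq : ¬ Bornology.IsBounded (closure (A.cell q))} :
    unboundedFace p hp ≤ unboundedFace q hq ↔ q ∈ closure (A.cell p) := by
  rw [← closure_cell_subset]
  exact WithTop.coe_le_coe.trans WithBot.coe_le_coe

theorem unboundedFace_eq {hp : ¬ Bornology.IsBounded (closure (A.cell p))}
    {hq : ¬ Bornology.IsBounded (closure (A.cell q))} :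
    unboundedFace p hp = unboundedFace q hq ↔
      ∀ i, SignType.sign (A.form i p) = SignType.sign (A.form i q) := by
  rw [← closure_cell_eq]
  constructor
  · intro h
    exact Set.Subset.antisymm (closure_cell_subset.2 (unboundedFace_le.1 h.ge))
      (closure_cell_subset.2 (unboundedFace_le.1 h.le))
  · intro h
    exact le_antisymm (unboundedFace_le.2 (closure_cell_subset.1 h.ge))
      (unboundedFace_le.2 (closure_cell_subset.1 h.le))

theorem zub_top : A.zub ⊤ = ⊤ := rfl

theorem zub_bot : A.zub ⊥ = ⊥ := rfl

theorem zub_unboundedFace (hp : ¬ Bornology.IsBounded (closure (A.cell p))) :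
    A.zub (unboundedFace p hp) = A.mkFlat {i | A.form i p = 0} := by
  refine congrArg WithBot.some (Subtype.ext ?_)
  exact congrArg OrderDual.toDual (affineSpan_closure_cell p)

theorem mem_flatOf_zub (hp : ¬ Bornology.IsBounded (closure (A.cell p))) :
    p ∈ A.flatOf (A.zub (unboundedFace p hp)) := by
  rw [zub_unboundedFace, flatOf_mkFlat, mem_flat]
  exact fun i hi => hi

theorem zub_unboundedFace_ne_top (hnc : A.IsNonCentral)
    (hp : ¬ Bornology.IsBounded (closure (A.cell p))) : A.zub (unboundedFace p hp) ≠ ⊤ := by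
  intro h
  have := mem_flatOf_zub hp
  rw [h, flatOf_top hnc] at this
  exact AffineSubspace.notMem_bot ℝ _ p this

theorem zub_unboundedFace_ne_bot (hp : ¬ Bornology.IsBounded (closure (A.cell p))) :
    A.zub (unboundedFace p hp) ≠ ⊥ := by
  rw [zub_unboundedFace]; exact mkFlat_ne_bot _

theorem zub_eq_top_iff (hnc : A.IsNonCentral) {a : A.UnboundedPoset} : A.zub a = ⊤ ↔ a = ⊤ := by
  refine ⟨fun h => ?_, fun h => by rw [h, zub_top]⟩
  rcases eq_top_or_eq_bot_or_exists a with rfl | rfl | ⟨p, hp, rfl⟩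
  · rfl
  · exact absurd h bot_ne_top
  · exact absurd h (zub_unboundedFace_ne_top hnc hp)

theorem zub_eq_bot_iff {a : A.UnboundedPoset} : A.zub a = ⊥ ↔ a = ⊥ := by
  refine ⟨fun h => ?_, fun h => by rw [h, zub_bot]⟩
  rcases eq_top_or_eq_bot_or_exists a with rfl | rfl | ⟨p, hp, rfl⟩
  · exact absurd h top_ne_bot
  · rfl
  · exact absurd h (zub_unboundedFace_ne_bot hp)

theorem exists_unboundedFace_of_zub {a : A.UnboundedPoset}
    (h0 : A.zub a ≠ ⊥) (h1 : A.zub a ≠ ⊤) : ∃ p hp, a = unboundedFace p hp := by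
  rcases eq_top_or_eq_bot_or_exists a with rfl | rfl | h
  · exact absurd zub_top h1
  · exact absurd zub_bot h0
  · exact h

theorem zub_strictMono (hnc : A.IsNonCentral) : StrictMono A.zub := by
  intro a b hab
  refine lt_of_le_of_ne (A.zub.monotone hab.le) fun h => hab.ne ?_
  by_cases h0 : A.zub a = ⊥
  · rw [zub_eq_bot_iff.1 h0, zub_eq_bot_iff.1 (h.symm.trans h0)]
  by_cases h1 : A.zub a = ⊤
  · rw [(zub_eq_top_iff hnc).1 h1, (zub_eq_top_iff hnc).1 (h.symm.trans h1)]
  obtain ⟨p, hp, rfl⟩ := exists_unboundedFace_of_zub h0 h1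
  obtain ⟨q, hq, rfl⟩ := exists_unboundedFace_of_zub (h ▸ h0) (h ▸ h1)
  have hpq := mem_flatOf_zub hp
  rw [h, zub_unboundedFace, flatOf_mkFlat, mem_flat] at hpq
  rw [unboundedFace_eq]
  intro i
  rcases mem_closure_cell.1 (unboundedFace_le.1 hab.le) i with h2 | h2
  · rw [h2, hpq i h2]
  · exact h2.symm

instance : Finite A.UnboundedPoset := by
  have : Set.Finite {F : Set (EuclideanSpace ℝ (Fin n)) |
      A.IsFace F ∧ ¬ Bornology.IsBounded F} := by
    refine (Set.finite_range fun σ : Fin m → SignType =>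
      closure {q | ∀ i, SignType.sign (A.form i q) = σ i}).subset ?_
    rintro _ ⟨⟨p, rfl⟩, -⟩
    exact ⟨fun i => SignType.sign (A.form i p), rfl⟩
  have : Finite A.UnboundedFace := this.to_subtype
  have : Finite (A.UnboundedFace)ᵒᵈ := this
  exact inferInstanceAs (Finite (Option (Option (A.UnboundedFace)ᵒᵈ)))

/-- The unbounded faces with affine hull `X` correspond to the cells in `X` whose recession cone
is not trivial. -/
theorem ncard_zub_eq (hess : A.IsEssential) (hnc : A.IsNonCentral) (hX0 : X ≠ ⊥) (hX1 : X ≠ ⊤) :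
    {a | A.zub a = X}.ncard =
      {σ ∈ A.localCells ⊤ X | ¬ A.RecTrivial ⊤ (A.localIdx ⊤) σ}.card := by
  rw [localIdx_top hnc, ← Set.ncard_coe_finset]
  have hrep : ∀ σ ∈ ({σ ∈ A.localCells ⊤ X | ¬ A.RecTrivial ⊤ Finset.univ σ} :
      Finset (Fin m → SignType)), ∃ p, A.signs Finset.univ p = σ ∧
      ¬ Bornology.IsBounded (closure (A.cell p)) ∧ A.mkFlat {i | A.form i p = 0} = X := by
    intro σ hσ
    rw [Finset.mem_filter, mem_localCells, localIdx_top hnc] at hσ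
    obtain ⟨⟨⟨p, rfl⟩, hX⟩, hR⟩ := hσ
    refine ⟨p, rfl, by rwa [isBounded_closure_cell_iff hess], ?_⟩
    rw [← hX, zeroFlat]
    simp [signs_eq_zero]
  symm
  refine Set.ncard_congr (fun σ hσ => unboundedFace _ (hrep σ hσ).choose_spec.2.1) ?_ ?_ ?_
  · intro σ hσ
    rw [Set.mem_ofPred_eq, zub_unboundedFace]
    exact (hrep σ hσ).choose_spec.2.2
  · intro σ τ hσ hτ h
    rw [unboundedFace_eq] at h
    rw [← (hrep σ hσ).choose_spec.1, ← (hrep τ hτ).choose_spec.1]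
    exact signs_eq_signs.2 fun i _ => h i
  · intro a (ha : A.zub a = X)
    obtain ⟨p, hp, rfl⟩ := exists_unboundedFace_of_zub (ha ▸ hX0) (ha ▸ hX1)
    have hmem : A.signs Finset.univ p ∈ ({σ ∈ A.localCells ⊤ X |
        ¬ A.RecTrivial ⊤ Finset.univ σ} : Finset (Fin m → SignType)) := by
      rw [Finset.mem_filter, mem_localCells, localIdx_top hnc]
      refine ⟨⟨⟨p, rfl⟩, ?_⟩, by rwa [← isBounded_closure_cell_iff hess]⟩
      rw [← ha, zub_unboundedFace, zeroFlat]
      simp [signs_eq_zero]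
    refine ⟨_, hmem, unboundedFace_eq.2 fun i => ?_⟩
    exact signs_eq_signs.1 (hrep _ hmem).choose_spec.1 i (Finset.mem_univ i)

/-- The faces with affine hull `X` that contain a given face with affine hull `Y` correspond to the
cells in `X` of the arrangement formed by the hyperplanes that contain `Y`. -/
theorem ncard_le_zub_eq (hX0 : X ≠ ⊥) (hXY : X ≤ Y) (hY1 : Y ≠ ⊤)
    {b : A.UnboundedPoset} (hb : A.zub b = Y) :
    {a | a ≤ b ∧ A.zub a = X}.ncard = (A.localCells Y X).card := by
  have hY0 : Y ≠ ⊥ := (lt_of_lt_of_le (bot_lt_iff_ne_bot.2 hX0) hXY).ne'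
  have hX1 : X ≠ ⊤ := (lt_of_le_of_lt hXY (lt_top_iff_ne_top.2 hY1)).ne
  obtain ⟨p, hp, rfl⟩ := exists_unboundedFace_of_zub (hb ▸ hY0) (hb ▸ hY1)
  have hidx : ∀ i, i ∈ A.localIdx Y ↔ A.form i p = 0 := by
    intro i
    rw [mem_localIdx]
    constructor
    · intro h
      exact A.mem_hyperplane.1 (h (hb ▸ mem_flatOf_zub hp))
    · intro hi x hx
      rw [← hb, zub_unboundedFace] at hx
      exact A.mem_hyperplane.2 (A.mem_flat.1 hx i hi)
  rw [← Set.ncard_coe_finset]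
  -- A local cell is realized close to `p`, by a point of a face that contains the face of `p`.
  have hrep : ∀ σ ∈ A.localCells Y X, ∃ q, A.signs (A.localIdx Y) q = σ ∧
      (∀ i ∉ A.localIdx Y, SignType.sign (A.form i q) = SignType.sign (A.form i p)) ∧
      p ∈ closure (A.cell q) ∧ A.mkFlat {i | A.form i q = 0} = X := by
    intro σ hσ
    rw [mem_localCells] at hσ
    obtain ⟨⟨r, rfl⟩, hX⟩ := hσ
    obtain ⟨ε, hε, H⟩ := exists_pos_signs_add_smul (A := A) (S := (A.localIdx Y)ᶜ) (p := p)
      (v := r - p) (fun i hi => by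
        rw [signs_eq_zero, Finset.mem_compl, hidx] at hi
        exact absurd hi.2 hi.1)
    have h1 : ∀ i ∈ A.localIdx Y, SignType.sign (A.form i (p + ε • (r - p))) =
        SignType.sign (A.form i r) := by
      intro i hi
      rw [form_add_smul, lin_sub, (hidx i).1 hi, zero_add, sub_zero, sign_mul, sign_pos hε,
        one_mul]
    have h2 : ∀ i ∉ A.localIdx Y, SignType.sign (A.form i (p + ε • (r - p))) =
        SignType.sign (A.form i p) := fun i hi =>
      signs_eq_signs.1 (H ε (by rw [abs_of_pos hε])) i (Finset.mem_compl.2 hi)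
    refine ⟨p + ε • (r - p), signs_eq_signs.2 h1, h2, ?_, ?_⟩
    · rw [mem_closure_cell]
      intro i
      by_cases hi : i ∈ A.localIdx Y
      · exact Or.inl ((hidx i).1 hi)
      · exact Or.inr (h2 i hi).symm
    · rw [← hX, zeroFlat]
      congr 1
      ext i
      rw [Set.mem_ofPred_eq, Set.mem_ofPred_eq, signs_eq_zero, ← sign_eq_zero_iff]
      by_cases hi : i ∈ A.localIdx Y
      · rw [h1 i hi, sign_eq_zero_iff]
        exact (and_iff_right hi).symm
      · rw [h2 i hi, sign_eq_zero_iff, ← hidx]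
        simp [hi]
  have hunb : ∀ {q}, p ∈ closure (A.cell q) → ¬ Bornology.IsBounded (closure (A.cell q)) :=
    fun h hbd => hp (hbd.subset (closure_cell_subset.2 h))
  symm
  refine Set.ncard_congr (fun σ hσ => unboundedFace _ (hunb (hrep σ hσ).choose_spec.2.2.1)) ?_ ?_ ?_
  · intro σ hσ
    rw [Set.mem_ofPred_eq, zub_unboundedFace, unboundedFace_le]
    exact (hrep σ hσ).choose_spec.2.2
  · intro σ τ hσ hτ h
    rw [unboundedFace_eq] at h
    rw [← (hrep σ hσ).choose_spec.1, ← (hrep τ hτ).choose_spec.1]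
    exact signs_eq_signs.2 fun i _ => h i
  · rintro a ⟨hab, ha⟩
    obtain ⟨q, hq, rfl⟩ := exists_unboundedFace_of_zub (ha ▸ hX0) (ha ▸ hX1)
    rw [unboundedFace_le, mem_closure_cell] at hab
    have hmem : A.signs (A.localIdx Y) q ∈ A.localCells Y X := by
      rw [mem_localCells]
      refine ⟨⟨q, rfl⟩, ?_⟩
      rw [← ha, zub_unboundedFace, zeroFlat]
      congr 1
      ext i
      rw [Set.mem_ofPred_eq, Set.mem_ofPred_eq, signs_eq_zero, hidx]
      refine ⟨fun h => h.2, fun h => ⟨(hab i).elim id fun h' => ?_, h⟩⟩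
      rwa [h, sign_zero, sign_eq_zero_iff] at h'
    refine ⟨_, hmem, unboundedFace_eq.2 fun i => ?_⟩
    by_cases hi : i ∈ A.localIdx Y
    · exact signs_eq_signs.1 (hrep _ hmem).choose_spec.1 i hi
    · rw [(hrep _ hmem).choose_spec.2.1 i hi]
      exact (hab i).resolve_left fun h => hi ((hidx i).2 h)

end Faces

end HyperplaneArrangement

end

/-! ### Counting chains over a chain -/

section Chains

theorem Set.ncard_eq_mul_of_fibers {α β : Type*} [Finite α] [Finite β] {s : Set α} {t : Set β}
    (f : α → β) (N : ℕ) (hf : Set.MapsTo f s t) (hN : ∀ b ∈ t, {a ∈ s | f a = b}.ncard = N) :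
    s.ncard = t.ncard * N := by
  classical
  have h := Finset.card_eq_sum_card_fiberwise (f := f) (s := s.toFinite.toFinset)
    (t := t.toFinite.toFinset) (by simpa using hf)
  rw [Set.ncard_eq_toFinset_card s, Set.ncard_eq_toFinset_card t, h]
  refine Finset.sum_const_nat fun b hb => ?_
  rw [← hN b (by simpa using hb), ← Set.ncard_coe_finset]
  congr 1
  ext a
  simp

variable {Q P : Type*} [PartialOrder Q] [PartialOrder P] {z : Q → P}

theorem StrictMono.eq_of_isChain (hz : StrictMono z) {d : Set Q} (hd : IsChain (· ≤ ·) d)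
    {a b : Q} (ha : a ∈ d) (hb : b ∈ d) (h : z a = z b) : a = b := by
  by_contra hne
  rcases hd ha hb hne with hle | hle
  · exact (hz (lt_of_le_of_ne hle hne)).ne h
  · exact (hz (lt_of_le_of_ne hle (Ne.symm hne))).ne h.symm

/-- Chains over a given chain are counted from the top down: if each element over `x (i + 1)` has
the same number `N i` of elements below it over `x i`, the numbers multiply. -/
theorem ncard_chains_over [Finite Q] (hz : StrictMono z) (k : ℕ) (x : ℕ → P)
    (hx : ∀ i < k, x i < x (i + 1)) (N : ℕ → ℕ)
    (hN : ∀ i < k, ∀ b, z b = x (i + 1) → {a | a ≤ b ∧ z a = x i}.ncard = N i) :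
    {d : Set Q | IsChain (· ≤ ·) d ∧ z '' d = x '' Set.Iic k}.ncard =
      {a | z a = x k}.ncard * ∏ i ∈ Finset.range k, N i := by
  induction k generalizing x N with
  | zero =>
    rw [Finset.prod_range_zero, mul_one,
      ← Set.ncard_image_of_injective {a | z a = x 0} Set.singleton_injective]
    congr 1
    ext d
    have h0 : x '' Set.Iic 0 = {x 0} := by
      rw [show Set.Iic (0 : ℕ) = {0} from Set.Iic_bot, Set.image_singleton]
    rw [Set.mem_ofPred_eq, h0]
    constructor
    · rintro ⟨hd, hzd⟩
      obtain ⟨a, ha, hza⟩ : x 0 ∈ z '' d := hzd ▸ Set.mem_singleton _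
      refine ⟨a, hza, (Set.eq_singleton_iff_unique_mem.2 ⟨ha, fun b hb => ?_⟩).symm⟩
      have : z b ∈ z '' d := ⟨b, hb, rfl⟩
      rw [hzd, Set.mem_singleton_iff] at this
      exact hz.eq_of_isChain hd hb ha (this.trans hza.symm)
    · rintro ⟨a, ha, rfl⟩
      exact ⟨Set.subsingleton_singleton.isChain, by rw [Set.image_singleton, ha]⟩
  | succ k ih =>
    have ih := ih (fun i => x (i + 1)) (fun i hi => hx _ (by omega)) (fun i => N (i + 1))
      (fun i hi => hN _ (by omega))
    rw [Finset.prod_range_succ', ← mul_assoc, ← ih]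
    have hmono : ∀ j ≤ k, x 1 ≤ x (j + 1) := by
      intro j
      induction j with
      | zero => exact fun _ => le_rfl
      | succ j ihj => exact fun hj => (ihj (by omega)).trans (hx _ (by omega)).le
    have h01 : x 0 < x 1 := hx 0 (by omega)
    have hne : ∀ j ≤ k, x (j + 1) ≠ x 0 := fun j hj => (h01.trans_le (hmono j hj)).ne'
    -- Removing the element over `x 0` leaves a chain over the rest.
    refine Set.ncard_eq_mul_of_fibers (fun d => {a ∈ d | z a ≠ x 0}) (N 0) ?_ ?_
    · rintro d ⟨hd, hzd⟩
      refine ⟨hd.mono fun a ha => ha.1, ?_⟩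
      ext y
      constructor
      · rintro ⟨a, ⟨ha, hza⟩, rfl⟩
        obtain ⟨j, hj, hja⟩ : z a ∈ x '' Set.Iic (k + 1) := hzd ▸ ⟨a, ha, rfl⟩
        obtain _ | j := j
        · exact absurd hja.symm hza
        · exact ⟨j, Nat.le_of_succ_le_succ hj, hja⟩
      · rintro ⟨j, hj, rfl⟩
        obtain ⟨a, ha, hza⟩ : x (j + 1) ∈ z '' d := hzd ▸ ⟨j + 1, Nat.succ_le_succ hj, rfl⟩
        exact ⟨a, ⟨ha, hza ▸ hne j hj⟩, hza⟩
    · rintro d ⟨hd, hzd⟩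
      obtain ⟨b, hb, hzb⟩ : x 1 ∈ z '' d := hzd ▸ ⟨0, Nat.zero_le k, rfl⟩
      have hzne : ∀ c ∈ d, z c ≠ x 0 ∧ x 1 ≤ z c := by
        intro c hc
        obtain ⟨j, hj, hjc⟩ : z c ∈ (fun i => x (i + 1)) '' Set.Iic k := hzd ▸ ⟨c, hc, rfl⟩
        rw [← hjc]
        exact ⟨hne j hj, hmono j hj⟩
      have hmin : ∀ c ∈ d, b ≤ c := by
        intro c hc
        rcases hd.total hb hc with h | h
        · exact h
        · exact (hz.eq_of_isChain hd hb hc (le_antisymm (hzb.trans_le (hzne c hc).2)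
            (hz.monotone h))).le
      rw [← hN 0 (by omega) b hzb]
      have hinj : Set.InjOn (fun a => insert a d) {a | a ≤ b ∧ z a = x 0} := by
        rintro a ⟨-, ha⟩ c - (hac : insert a d = insert c d)
        rcases (hac ▸ Set.mem_insert a d : a ∈ insert c d) with h | h
        · exact h
        · exact absurd ha (hzne a h).1
      rw [← hinj.ncard_image]
      congr 1
      ext e
      constructor
      · rintro ⟨⟨he, hze⟩, rfl⟩
        obtain ⟨a, ha, hza⟩ : x 0 ∈ z '' e := hze ▸ ⟨0, Nat.zero_le _, rfl⟩
        refine ⟨a, ⟨?_, hza⟩, ?_⟩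
        · rcases he.total ha hb.1 with h | h
          · exact h
          · exact absurd (hz.monotone h) (by rw [hza, hzb]; exact h01.not_ge)
        · ext c
          constructor
          · rintro (rfl | hc)
            · exact ha
            · exact hc.1
          · intro hc
            by_cases hzc : z c = x 0
            · exact Or.inl (hz.eq_of_isChain he hc ha (hzc.trans hza.symm))
            · exact Or.inr ⟨hc, hzc⟩
      · rintro ⟨a, ⟨hab, hza⟩, rfl⟩
        refine ⟨⟨hd.insert fun c hc _ => Or.inl (hab.trans (hmin c hc)), ?_⟩, ?_⟩
        · rw [Set.image_insert_eq, hzd, hza]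
          ext y
          constructor
          · rintro (rfl | ⟨j, hj, rfl⟩)
            · exact ⟨0, Nat.zero_le _, rfl⟩
            · exact ⟨j + 1, Nat.succ_le_succ hj, rfl⟩
          · rintro ⟨_ | j, hj, rfl⟩
            · exact Or.inl rfl
            · exact Or.inr ⟨j, Nat.le_of_succ_le_succ hj, rfl⟩
        · ext c
          constructor
          · rintro ⟨rfl | hc, hzc⟩
            · exact absurd hza hzc
            · exact hc
          · exact fun hc => ⟨Or.inr hc, (hzne c hc).1⟩

end Chains

open HyperplaneArrangement in
theorem mainTheorem4 {n m : ℕ} (A : HyperplaneArrangement n m)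
    (hess : A.IsEssential) (hnc : A.IsNonCentral)
    (k : ℕ) (hk : 2 ≤ k) (x : ℕ → WithBot A.IntersectionLattice)
    (hx0 : x 0 = ⊥) (hxk : x k = ⊤) (hx : ∀ i < k, x i < x (i + 1)) :
    {d : Set A.UnboundedPoset | IsChain (· ≤ ·) d ∧ A.zub '' d = x '' Set.Iic k}.Finite ∧
    (({d : Set A.UnboundedPoset |
        IsChain (· ≤ ·) d ∧ A.zub '' d = x '' Set.Iic k}.ncard : ℕ) : ℤ) =
      (∏ i ∈ Finset.Icc 2 (k - 1), zaslavsky (x (i - 1)) (x i)) *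
        zaslavskyUnbounded (x (k - 1)) (x k) := by
  refine ⟨Set.toFinite _, ?_⟩
  obtain ⟨l, rfl⟩ := Nat.exists_eq_add_of_le' hk
  rw [show l + 2 - 1 = l + 1 from rfl, hxk]
  have hbot : ∀ i < l + 2, x (i + 1) ≠ ⊥ := fun i hi => (bot_le.trans_lt (hx i hi)).ne'
  have htop : ∀ i < l + 2, x i ≠ ⊤ := fun i hi => ((hx i hi).trans_le le_top).ne
  have hflat : ∀ i < l + 1, A.flatOf (x (i + 1)) ≠ ⊥ := fun i hi h =>
    htop (i + 1) (by omega) ((flatOf_eq_bot_iff hnc (hbot i (by omega))).1 h)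
  -- `⊥` is the only element over `x 0`; the numbers at the other steps are the local counts.
  have hcount := ncard_chains_over (zub_strictMono hnc) (l + 2) x hx
    (fun i => if i = 0 then 1 else if i = l + 1 then {a | A.zub a = x (l + 1)}.ncard
      else (A.localCells (x (i + 1)) (x i)).card) (by
      intro i hi b hb
      split_ifs with h0 h1
      · rw [h0, hx0]
        simp only [zub_eq_bot_iff]
        rw [show {a | a ≤ b ∧ a = ⊥} = {(⊥ : A.UnboundedPoset)} by
          ext a
          exact ⟨fun h => h.2, fun h => ⟨h.le.trans bot_le, h⟩⟩, Set.ncard_singleton]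
      · subst h1
        rw [hxk, zub_eq_top_iff hnc] at hb
        rw [hb]
        simp only [le_top, true_and]
      · obtain ⟨j, rfl⟩ := Nat.exists_eq_succ_of_ne_zero h0
        exact ncard_le_zub_eq (hbot j (by omega)) (hx _ hi).le (htop _ (by omega)) hb)
  have hone : {a | A.zub a = x (l + 2)}.ncard = 1 := by
    rw [hxk]
    simp only [zub_eq_top_iff hnc]
    exact Set.ncard_singleton _
  rw [hcount, hone, one_mul, Finset.prod_range_succ, Finset.prod_range_succ', if_pos rfl, mul_one,
    if_neg (Nat.succ_ne_zero l), if_pos rfl, Nat.cast_mul, Nat.cast_prod,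
    ncard_zub_eq hess hnc (hbot l (by omega)) (htop _ (by omega)),
    card_localCells_not_recTrivial hess hnc (hbot l (by omega)) (hflat l (by omega))]
  congr 1
  rw [show Finset.Icc 2 (l + 1) = Finset.Ico 2 (l + 2) from rfl, Finset.prod_Ico_eq_prod_range]
  refine Finset.prod_congr (by simp) fun i hi => ?_
  rw [Finset.mem_range] at hi
  rw [if_neg (Nat.succ_ne_zero i), if_neg (by omega),
    card_localCells hess hnc (hbot i (by omega)) (hx (i + 1) (by omega)).le
      (hflat (i + 1) (by omega)), show 2 + i - 1 = i + 1 by omega, show 2 + i = i + 1 + 1 by omega]
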